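/- Let $n\ge 1$, $[m]=\{1,\dots,m\}$ and $[a,b]=\{a,a+1,\dots,b\}$. **Tableaux.** Let $\mathcal T_n$ be the set of tableaux $T$ with $n$ columns $C_1,\dots,C_n$ (from left to right) and $2n$ rows, containing $2n$ dots, such that every row contains exactly one dot, every column exactly two dots, and a dot in column $C_j$ and in the $y$-th row from the bottom satisfies $j\le y$. From bottom to top the rows are named $R_1,\dots,R_n,R_{2n-1},R_{2n-2},\dots,R_{n+1},R_{2n}$, and $d_i$ is the dot of $R_i$. A dot in $C_j$ and in the $y$-th row from the bottom is *free* if $y\ge 2n+1-j$. For $i\in[n]$ the dots $d_i$ and $d_{n+i}$ are *twins*; $d_{i,\min}$ is $d_i$ if the column of $d_i$ is weakly to the left of that of $d_{n+i}$, and $d_{n+i}$ otherwise. **Paths.** Let $j\in[n]$, let $T$ be a (possibly partial) tableau whose columns $C_1,\dots,C_{j-1}$ contain two dots each, whose rows $R_1,\dots,R_{j-1}$ contain one dot each, whose other columns and rows contain at most two dots and at most one dot respectively, and which has no dot below the line $y=x$. For $i\in[j,2n]$ such that the first $j-1$ boxes of $R_i$ are empty, define $i_0=i$; $i_{k+1}=i_k$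 if $i_k\in[j,n]\sqcup[n+j,2n]$; $d_{i_{k+1}}$ is the upper dot of $C_{i_k-n}$ if $i_k\in[n+1,n+j-1]$; and $d_{i_{k+1}}$ is the lower dot of $C_{i_k}$ if $i_k\in[j-1]$. This sequence is eventually constant with value in $[j,n]\sqcup[n+j,2n]$; this value is denoted $\pi_j^T(i)$, and $\pi^T_j$ is a bijection onto $[j,n]\sqcup[n+j,2n]$. **Pistol labeling of $T\in\mathcal T_n$.** For $j=n,n-1,\dots,1$, each dot $d_i$ of $C_j$ receives a digital label $h$, a type label $t\in\{\alpha,\beta\}$ and a parity label $p\in\{o,e\}$, together written $t_h^p$. Put $i'=\pi_j^T(i)$. The digital label is $h=i'-j$ if $i'\le n$, and $h=i'-n-j$ otherwise. Put $j'=j+h$. * *Type label if $j'>j$.* If a dot of $C_{j'}$ is labeled $\beta_0^e$, the type is $\alpha$ if $i'=j'$, and $\beta$ if $i'=n+j'$. Otherwise let $(\gamma,\bar\gamma)=(\alpha,\beta)$ if the two dots of $C_{j'}$ have different types and $(\beta,\alpha)$ if not; the type is $\gamma$ if $d_{i'}=d_{j',\min}$, and $\bar\gamma$ if not. * *Type label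 if $j'=j$.* Let $d$ be the other dot of $C_j$. If $d$ has digital label $0$, the type of $d_i$ is $\alpha$ if $i'=j$, and $\beta$ if $i'=n+j$. Otherwise the type of $d$ is given by the previous rule; if it is $\alpha$, the type of $d_i$ is $\alpha$ if $i\ne i'=j$, and $\beta$ otherwise; if it is $\beta$, the type of $d_i$ is $\alpha$ if $d_{i'}=d_{j,\min}$, and $\beta$ otherwise. * *Parity labels.* If the dots of $C_j$ have different types, the one of type $\alpha$ gets $o$ and the one of type $\beta$ gets $e$. If both have type $\alpha$, the one with the smaller digital label gets $e$ and the other $o$; if both have type $\beta$, the one with the smaller digital label gets $o$ and the other $e$ (in these two cases the digital labels are distinct). **The map $\varphi$.** Let $SP_n$ be the set of surjective maps $f:[2n]\to\{2,4,\dots,2n\}$ with $f(k)\ge k$ for all $k$. For $T\in\mathcal T_n$ and $j\in[n]$, let $h_o$ be the digital label of the dot of $C_j$ with parity $o$, and $h_e$, $t_e$ the digital and type labels of the one with parity $e$. Put $\varphi(T)(2j-1)=2(j+h_o)$, and $\varphi(T)(2j)=2(j+h_o)$ if $t_e=\alpha$ and $h_e=0$, $\varphi(T)(2j)=2(j+h_e)$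 otherwise. **The map $\Phi$.** Let $f\in SP_n$. Start with the empty tableau $T^1$. In step $j=1,\dots,n$, obtain $T^{j+1}$ from $T^j$ by plotting two dots of $C_j$, labeled with $a$ or $b$, as follows. Let $(\delta_o,\delta_e)=(f(2j-1)/2-j,\ f(2j)/2-j)$. If $R_j$ is empty or its dot is labeled $a$, put $(l_o,l_e)=(a,b)$; otherwise put $(l_o,l_e)=(b,b)$ if $\delta_o<\delta_e$, and $(a,a)$ if $\delta_o\ge\delta_e$. Let $h_o=\delta_o$, and let $h_e=0$ if $l_e=a$ and $\delta_o=\delta_e$, $h_e=\delta_e$ otherwise. Insert into $T^j$ a dot with label $l_o$ at height $h_o$, and then, into the result, a dot with label $l_e$ at height $h_e$. Here, *inserting a dot in the box $C_j\cap R_i$* (for $i\in[j,n]\sqcup[n+j,2n]$) means plotting it in the box $C_j\cap R_{i'}$ with $\pi_j(i')=i$, and inserting a dot with label $l$ at height $h$ means, with $i=j+h$: * if $i=j$: insert it in $C_j\cap R_j$ if $R_j$ is empty or $l=a$, and in $C_j\cap R_{n+j}$ otherwise; * if $i>j$ and $R_i$ is empty: insert it in $C_j\cap R_{n+i}$ if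 $l=b$ and $f(2i)=2i$, and in $C_j\cap R_i$ otherwise; * if $i>j$ and $R_i$ has a dot, with label $l'$: insert it in $C_j\cap R_i$ if $l=l'$, and in $C_j\cap R_{n+i}$ otherwise. Then $\Phi(f)$ is the tableau $T^{n+1}$, with its labels forgotten. **The subset $\tilde{\mathcal T}_n$.** For $T\in\mathcal T_n$ let $\mathcal S(T)$ be the set of $i\in[n]$ such that $d_{n+i}$ is not free, $d_i$ and $d_{n+i}$ are not in the same column, and no dot of $C_i$ is labeled $\beta_0^e$. Let $\mathcal C(T)$ be the set of $j\in[n]$ such that the dots of $C_j$ are twins $d_i,d_{n+i}$ for some $i\in[n]$ for which no dot of $C_i$ is labeled $\beta_0^e$; for such $j$ let $t_T(j)$ be the type label of $d_i$. Let $\tilde{\mathcal T}_n$ be the set of $T\in\mathcal T_n$ such that (a) $d_{i,\min}=d_i$ for all $i\in\mathcal S(T)$, and (b) $t_T(j)=\alpha$ for all $j\in\mathcal C(T)$. **Statement.** The above defines maps $\varphi:\mathcal T_n\to SP_n$ and $\Phi:SP_n\to\mathcal T_n$. The restriction of $\varphi$ to $\tilde{\mathcal T}_n$ is injective, and $\Phi(\varphi(T))=T$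 for all $T\in\tilde{\mathcal T}_n$. The image of $\Phi$ is exactly $\tilde{\mathcal T}_n$, and $\Phi$ is a bijection from $SP_n$ onto $\tilde{\mathcal T}_n$. -/

import Mathlib

namespace SymplecticDellac

/-! Tableaux. A tableau with `n` columns and `2 * n` rows is a finite set of boxes containing a dot.
A box is a pair `(j, i)`: column `C_j` (from left to right) and row *named* `R_i`, where from bottom
to top the rows are named `R_1, …, R_n, R_{2n-1}, R_{2n-2}, …, R_{n+1}, R_{2n}`. -/

/-- The level (from bottom to top, starting at `1`) of the row named `R_i`. On `[1, 2n]` this is an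
involution, so that it also sends a level to the name of the row at this level. -/
def level (n i : ℕ) : ℕ := if i ≤ n ∨ i = 2 * n then i else 3 * n - i

/-- The names of the rows that have a dot in the column `C_j`. -/
def colDots (T : Finset (ℕ × ℕ)) (j : ℕ) : Finset ℕ :=
  (T.filter (fun b => b.1 = j)).image Prod.snd

/-- The indices of the columns that have a dot in the row `R_i`. -/
def rowDots (T : Finset (ℕ × ℕ)) (i : ℕ) : Finset ℕ :=
  (T.filter (fun b => b.2 = i)).image Prod.fst

/-- The set `𝒯_n` of tableaux with exactly one dot in every row, exactly two dots in every column,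
and no dot below the line `y = x`. -/
def Tab (n : ℕ) : Set (Finset (ℕ × ℕ)) :=
  {T | (∀ b ∈ T, b.1 ∈ Finset.Icc 1 n ∧ b.2 ∈ Finset.Icc 1 (2 * n) ∧ b.1 ≤ level n b.2) ∧
    (∀ i ∈ Finset.Icc 1 (2 * n), (rowDots T i).card = 1) ∧
    (∀ j ∈ Finset.Icc 1 n, (colDots T j).card = 2)}

/-- The index of the column that contains the dot `d_i` of the row `R_i`. -/
def colOf (T : Finset (ℕ × ℕ)) (i : ℕ) : ℕ := (rowDots T i).sup id

/-- The name of the row of the upper dot of the column `C_k`. -/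
def upperDot (n : ℕ) (T : Finset (ℕ × ℕ)) (k : ℕ) : ℕ :=
  level n (((colDots T k).image (level n)).max.unbotD 0)

/-- The name of the row of the lower dot of the column `C_k`. -/
def lowerDot (n : ℕ) (T : Finset (ℕ × ℕ)) (k : ℕ) : ℕ :=
  level n (((colDots T k).image (level n)).min.untopD 0)

/-- For a dot `d_i` of a column with two dots, the other dot of the column. -/
def otherDot (T : Finset (ℕ × ℕ)) (i : ℕ) : ℕ := ((colDots T (colOf T i)).erase i).sup id

/-- The dot `d_i` is free. -/
def IsFree (n : ℕ) (T : Finset (ℕ × ℕ)) (i : ℕ) : Prop := 2 * n + 1 - colOf T i ≤ level n i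

/-- The dot `d_{i,min}`: `d_i` if it lies weakly to the left of its twin `d_{n+i}`,
and `d_{n+i}` otherwise. -/
def dmin (n : ℕ) (T : Finset (ℕ × ℕ)) (i : ℕ) : ℕ :=
  if colOf T i ≤ colOf T (n + i) then i else n + i

/-! Paths in a tableau. Only the dots of the columns `C_1, …, C_{j-1}` matter. -/

/-- `i ∈ [j, n] ⊔ [n + j, 2n]`. -/
def Settled (n j i : ℕ) : Prop := (j ≤ i ∧ i ≤ n) ∨ (n + j ≤ i ∧ i ≤ 2 * n)

instance (n j i : ℕ) : Decidable (Settled n j i) := by unfold Settled; infer_instance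

/-- The rule that gives `i_{k+1}` from `i_k` in a path starting in the column `C_j`. -/
def pathStep (n : ℕ) (T : Finset (ℕ × ℕ)) (j i : ℕ) : ℕ :=
  if Settled n j i then i else if n < i then upperDot n T (i - n) else lowerDot n T i

/-- The path `(i_0, i_1, …)` from the box `C_j ∩ R_i`. -/
def tPath (n : ℕ) (T : Finset (ℕ × ℕ)) (j i k : ℕ) : ℕ := (pathStep n T j)^[k] i

/-- The arrival `π_j(i)` of the path from the box `C_j ∩ R_i`. A path takes its values in `[1, 2n]`
and each term determines the next one, so, if it is eventually stationary, it is stationary from the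
index `2n` on. -/
def arrival (n : ℕ) (T : Finset (ℕ × ℕ)) (j i : ℕ) : ℕ := tPath n T j i (2 * n)

/-! The pistol labeling. -/

/-- Type labels. -/
inductive TypeLabel where
  | α
  | β
deriving DecidableEq

/-- Parity labels, odd and even. -/
inductive ParityLabel where
  | o
  | e
deriving DecidableEq

/-- Pistol labels. -/
structure PistolLabel where
  type : TypeLabel
  digit : ℕ
  parity : ParityLabel
deriving DecidableEq

/-- The digital label of the dot `d_i`, in the column `C_j`. -/
def digitOf (n : ℕ) (T : Finset (ℕ × ℕ)) (i : ℕ) : ℕ :=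
  if arrival n T (colOf T i) i ≤ n then arrival n T (colOf T i) i - colOf T i
  else arrival n T (colOf T i) i - n - colOf T i

/-- With respect to the labels `L` of the dots (indexed by the names of their rows), some dot of
`C_j` has the pistol label `β_0^e`. -/
def HasBetaZeroEven (T : Finset (ℕ × ℕ)) (L : ℕ → PistolLabel) (j : ℕ) : Prop :=
  ∃ i ∈ colDots T j, L i = ⟨TypeLabel.β, 0, ParityLabel.e⟩

instance (T : Finset (ℕ × ℕ)) (L : ℕ → PistolLabel) (j : ℕ) : Decidable (HasBetaZeroEven T L j) := by
  unfold HasBetaZeroEven; infer_instance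

/-- The dots of `C_j` have the same type label. -/
def SameType (T : Finset (ℕ × ℕ)) (L : ℕ → PistolLabel) (j : ℕ) : Prop :=
  ∀ i₁ ∈ colDots T j, ∀ i₂ ∈ colDots T j, (L i₁).type = (L i₂).type

instance (T : Finset (ℕ × ℕ)) (L : ℕ → PistolLabel) (j : ℕ) : Decidable (SameType T L j) := by
  unfold SameType; infer_instance

/-- The type label of the dot `d_i` of `C_j` when its digital label `h` is positive, where `L` gives
the labels of the columns to the right of `C_j`. Here `j' = j + h` and `i' = π_j(i)`. -/
def typePos (n : ℕ) (T : Finset (ℕ × ℕ)) (L : ℕ → PistolLabel) (i : ℕ) : TypeLabel :=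
  let j := colOf T i
  let j' := j + digitOf n T i
  let i' := arrival n T j i
  if HasBetaZeroEven T L j' then
    (if i' = j' then TypeLabel.α else TypeLabel.β)
  else if SameType T L j' then
    (if i' = dmin n T j' then TypeLabel.β else TypeLabel.α)
  else
    (if i' = dmin n T j' then TypeLabel.α else TypeLabel.β)

/-- The type label of the dot `d_i` of `C_j`, where `L` gives the labels of the columns to the right
of `C_j`. -/
def typeOf (n : ℕ) (T : Finset (ℕ × ℕ)) (L : ℕ → PistolLabel) (i : ℕ) : TypeLabel :=
  let j := colOf T i
  let i' := arrival n T j i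
  let d := otherDot T i
  if 0 < digitOf n T i then typePos n T L i
  else if digitOf n T d = 0 then
    (if i' = j then TypeLabel.α else TypeLabel.β)
  else match typePos n T L d with
    | TypeLabel.α => if i ≠ i' ∧ i' = j then TypeLabel.α else TypeLabel.β
    | TypeLabel.β => if i' = dmin n T j then TypeLabel.α else TypeLabel.β

/-- The parity label of the dot `d_i`: if the dots of the column have different types, `o` for the
dot of type `α` and `e` for the dot of type `β`; if both have type `α`, `e` for the dot with the
smaller digital label; if both have type `β`, `o` for the dot with the smaller digital label. -/
def parityOf (n : ℕ) (T : Finset (ℕ × ℕ)) (L : ℕ → PistolLabel) (i : ℕ) : ParityLabel :=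
  let d := otherDot T i
  match typeOf n T L i, typeOf n T L d with
  | TypeLabel.α, TypeLabel.β => ParityLabel.o
  | TypeLabel.β, TypeLabel.α => ParityLabel.e
  | TypeLabel.α, TypeLabel.α => if digitOf n T i < digitOf n T d then ParityLabel.e else ParityLabel.o
  | TypeLabel.β, TypeLabel.β => if digitOf n T i < digitOf n T d then ParityLabel.o else ParityLabel.e

/-- The labels of the dots after the `m` columns `C_n, C_{n-1}, …, C_{n-m+1}` have been labeled, in
this order (the value on the other dots is arbitrary). -/
def labelSteps (n : ℕ) (T : Finset (ℕ × ℕ)) : ℕ → ℕ → PistolLabel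
  | 0 => fun _ => ⟨TypeLabel.α, 0, ParityLabel.o⟩
  | m + 1 => fun i =>
      if colOf T i = n - m then
        ⟨typeOf n T (labelSteps n T m) i, digitOf n T i, parityOf n T (labelSteps n T m) i⟩
      else labelSteps n T m i

/-- The pistol labeling of `T`: the pistol label of the dot `d_i`. -/
def pistolLabel (n : ℕ) (T : Finset (ℕ × ℕ)) : ℕ → PistolLabel := labelSteps n T n

/-! Surjective pistols and the map from tableaux to surjective pistols. A map on `[2n]` is extended
by `0` to a function on `ℕ`. -/

/-- The set of the surjective pistols: maps from `[2n]` onto `{2, 4, …, 2n}` with `f k ≥ k`. -/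
def SP (n : ℕ) : Set (ℕ → ℕ) :=
  {f | (∀ k, k ∉ Set.Icc 1 (2 * n) → f k = 0) ∧
    f '' Set.Icc 1 (2 * n) = {m | ∃ i ∈ Set.Icc 1 n, m = 2 * i} ∧
    ∀ k ∈ Set.Icc 1 (2 * n), k ≤ f k}

/-- The dot of the column `C_j` with the given parity label. -/
def parityDot (n : ℕ) (T : Finset (ℕ × ℕ)) (p : ParityLabel) (j : ℕ) : ℕ :=
  ((colDots T j).filter (fun i => (pistolLabel n T i).parity = p)).sup id

/-- The map `φ` from tableaux to pistols. -/
def phi (n : ℕ) (T : Finset (ℕ × ℕ)) (k : ℕ) : ℕ :=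
  let j := (k + 1) / 2
  let lo := pistolLabel n T (parityDot n T ParityLabel.o j)
  let le := pistolLabel n T (parityDot n T ParityLabel.e j)
  if k ∈ Finset.Icc 1 (2 * n) then
    if k % 2 = 1 then 2 * (j + lo.digit)
    else if le.type = TypeLabel.α ∧ le.digit = 0 then 2 * (j + lo.digit)
    else 2 * (j + le.digit)
  else 0

/-! The map from surjective pistols to tableaux. -/

/-- Insertion labels. -/
inductive InsLabel where
  | a
  | b
deriving DecidableEq

/-- A (partial) tableau whose dots carry insertion labels; `lab i` is the label of the dot of the
row `R_i` (and is irrelevant if this row is empty). -/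
structure LabeledTableau where
  dots : Finset (ℕ × ℕ)
  lab : ℕ → InsLabel

/-- The rows `R_{i'}` with `i' ∈ [j, 2n]`, with empty boxes in the columns `C_1, …, C_j`, and with
`π_j(i') = i`. As `π_j` is injective, there is at most one such row. -/
def insertionRows (n : ℕ) (T : Finset (ℕ × ℕ)) (j i : ℕ) : Finset ℕ :=
  (Finset.Icc j (2 * n)).filter
    (fun i' => (∀ k ∈ rowDots T i', j < k) ∧ arrival n T j i' = i)

/-- The insertion of a dot labeled with `l` into the box `C_j ∩ R_i`: the dot is plotted in the box
`C_j ∩ R_{i'}` with `π_j(i') = i`. -/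
def insertBox (n j : ℕ) (U : LabeledTableau) (l : InsLabel) (i : ℕ) : LabeledTableau where
  dots := U.dots ∪ (insertionRows n U.dots j i).image (fun i' => (j, i'))
  lab := fun r => if r ∈ insertionRows n U.dots j i then l else U.lab r

/-- The `(f, j)`-insertion in `U` of a dot labeled with `l` at the height `h`. -/
def insertAt (n : ℕ) (f : ℕ → ℕ) (j : ℕ) (U : LabeledTableau) (l : InsLabel) (h : ℕ) :
    LabeledTableau :=
  let i := j + h
  if i = j then
    if rowDots U.dots j = ∅ then insertBox n j U l j
    else match l with
      | InsLabel.a => insertBox n j U l j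
      | InsLabel.b => insertBox n j U l (n + j)
  else
    if rowDots U.dots i = ∅ then
      if l = InsLabel.b ∧ f (2 * i) = 2 * i then insertBox n j U l (n + i)
      else insertBox n j U l i
    else if l = U.lab i then insertBox n j U l i
    else insertBox n j U l (n + i)

/-- The labels `(l_o, l_e)` used in the step `j`. -/
def stepLabels (f : ℕ → ℕ) (j : ℕ) (U : LabeledTableau) : InsLabel × InsLabel :=
  if rowDots U.dots j = ∅ then (InsLabel.a, InsLabel.b)
  else match U.lab j with
    | InsLabel.a => (InsLabel.a, InsLabel.b)
    | InsLabel.b =>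
      if f (2 * j - 1) / 2 - j < f (2 * j) / 2 - j then (InsLabel.b, InsLabel.b)
      else (InsLabel.a, InsLabel.a)

/-- The heights `(h_o, h_e)` used in the step `j`. -/
def stepHeights (f : ℕ → ℕ) (j : ℕ) (U : LabeledTableau) : ℕ × ℕ :=
  let δo := f (2 * j - 1) / 2 - j
  let δe := f (2 * j) / 2 - j
  (δo, if (stepLabels f j U).2 = InsLabel.a ∧ δo = δe then 0 else δe)

/-- The step `j`: filling the column `C_j`, by inserting the odd dot and then the even dot. -/
def insertStep (n : ℕ) (f : ℕ → ℕ) (j : ℕ) (U : LabeledTableau) : LabeledTableau :=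
  insertAt n f j
    (insertAt n f j U (stepLabels f j U).1 (stepHeights f j U).1)
    (stepLabels f j U).2 (stepHeights f j U).2

/-- The labeled tableau `T^{m+1}`, obtained from the empty one by the steps `1, …, m`. -/
def insertSteps (n : ℕ) (f : ℕ → ℕ) : ℕ → LabeledTableau
  | 0 => ⟨∅, fun _ => InsLabel.a⟩
  | m + 1 => insertStep n f (m + 1) (insertSteps n f m)

/-- The map `Φ` from surjective pistols to tableaux. -/
def Phi (n : ℕ) (f : ℕ → ℕ) : Finset (ℕ × ℕ) := (insertSteps n f n).dots

/-! The subset `𝒯̃_n` of `𝒯_n`. -/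

/-- `𝒮(T)`. -/
def setS (n : ℕ) (T : Finset (ℕ × ℕ)) : Set ℕ :=
  {i | i ∈ Finset.Icc 1 n ∧ ¬ IsFree n T (n + i) ∧ colOf T i ≠ colOf T (n + i) ∧
    ¬ HasBetaZeroEven T (pistolLabel n T) i}

/-- The dots of `C_j` are the twin dots `d_i` and `d_{n+i}`. -/
def ContainsTwins (n : ℕ) (T : Finset (ℕ × ℕ)) (j i : ℕ) : Prop :=
  i ∈ Finset.Icc 1 n ∧ colOf T i = j ∧ colOf T (n + i) = j

instance (n : ℕ) (T : Finset (ℕ × ℕ)) (j i : ℕ) : Decidable (ContainsTwins n T j i) := by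
  unfold ContainsTwins; infer_instance

/-- `𝒞(T)`. -/
def setC (n : ℕ) (T : Finset (ℕ × ℕ)) : Set ℕ :=
  {j | j ∈ Finset.Icc 1 n ∧
    ∃ i, ContainsTwins n T j i ∧ ¬ HasBetaZeroEven T (pistolLabel n T) i}

/-- `t_T(j)`: the type label of `d_i`, if the dots of `C_j` are the twin dots `d_i` and `d_{n+i}`. -/
def twinType (n : ℕ) (T : Finset (ℕ × ℕ)) (j : ℕ) : TypeLabel :=
  (pistolLabel n T (((Finset.Icc 1 n).filter (fun i => ContainsTwins n T j i)).sup id)).type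

/-- The set `𝒯̃_n` of the tableaux of `𝒯_n` with the properties (a) and (b). -/
def TabTilde (n : ℕ) : Set (Finset (ℕ × ℕ)) :=
  {T | T ∈ Tab n ∧ (∀ i ∈ setS n T, dmin n T i = i) ∧
    (∀ j ∈ setC n T, twinType n T j = TypeLabel.α)}

end SymplecticDellac

/-! The insertion algorithm is replaced by a static description. `Spec n f m T L` says that each
column `C_j` with `j ≤ m` consists of an odd and an even dot whose labels, heights and arrivals are
those prescribed by step `j`, given the columns to its left. The map `π_j` is a bijection, so every
insertion has exactly one possible row. Hence the algorithm run on `f ∈ SP n` produces a tableau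
with this property (`insertSteps_spec`), and a full tableau with this property for `f` must be
`Φ(f)` (`Phi_eq_of_spec`).

It remains to compare `Spec` with the pistol labeling under the dictionary `a ↔ α`, `b ↔ β`.
Insertion runs from left to right and looks at the dot of `R_i`; labeling runs from right to left
and looks at the column `C_i`. Three facts reconcile them: `C_i` contains `β_0^e` iff `f(2i) = 2i`;
the dots of `C_i` have the same type iff `R_i` has a dot labeled `b` strictly to the left of `C_i`;
and `d_{i,min} = d_i` whenever `f(2i) ≠ 2i`, because insertion then uses `R_i` before `R_{n+i}`.

Given `Spec`, a descending induction on the column (`exists_matches`) identifies the two labelings,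
which yields `φ(Φ(f)) = f` and the conditions (a) and (b). Conversely, for `T ∈ TabTilde n`,
condition (a) supplies `d_{i,min} = d_i` and condition (b) settles the case of twins in one column,
so that `T` with its type labels satisfies `Spec` for `φ(T)` (`spec_of_mem_TabTilde`), whence
`Φ(φ(T)) = T`. The two inverse identities give injectivity, image and bijectivity. -/

namespace SymplecticDellac

/-! ### Partial tableaux and the bijectivity of paths -/

section

variable {n j : ℕ} {T T' : Finset (ℕ × ℕ)}

theorem mem_colDots {i : ℕ} : i ∈ colDots T j ↔ (j, i) ∈ T := by
  simp [colDots]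

theorem mem_rowDots {i : ℕ} : j ∈ rowDots T i ↔ (j, i) ∈ T := by
  simp [rowDots]

theorem rowDots_eq_empty {i : ℕ} : rowDots T i = ∅ ↔ ∀ k, (k, i) ∉ T := by
  simp [Finset.eq_empty_iff_forall_notMem, mem_rowDots]

theorem level_level {i : ℕ} (h : i ≤ 2 * n) : level n (level n i) = i := by
  unfold level
  split_ifs <;> omega

/-- Since `level` is an involution on row names, distinct rows have distinct levels. Which dot is
the lower one never matters later, hence the disjunction. -/
theorem lowerDot_upperDot {k a b : ℕ} (h : colDots T k = {a, b}) (hab : a ≠ b)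
    (ha : a ≤ 2 * n) (hb : b ≤ 2 * n) :
    (lowerDot n T k = a ∧ upperDot n T k = b) ∨ (lowerDot n T k = b ∧ upperDot n T k = a) := by
  have hl : level n a ≠ level n b := fun e => hab (by rw [← level_level ha, e, level_level hb])
  have h1 : lowerDot n T k = level n (min (level n a) (level n b)) := by
    simp only [lowerDot, h, Finset.image_insert, Finset.image_singleton, Finset.min_insert,
      Finset.min_singleton]
    rw [← WithTop.coe_min, WithTop.untopD_coe]
  have h2 : upperDot n T k = level n (max (level n a) (level n b)) := by
    simp only [upperDot, h, Finset.image_insert, Finset.image_singleton, Finset.max_insert,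
      Finset.max_singleton]
    rw [← WithBot.coe_max, WithBot.unbotD_coe]
  rw [h1, h2]
  rcases lt_or_gt_of_ne hl with h | h
  · left
    rw [min_eq_left h.le, max_eq_right h.le, level_level ha, level_level hb]
    exact ⟨rfl, rfl⟩
  · right
    rw [min_eq_right h.le, max_eq_left h.le, level_level ha, level_level hb]
    exact ⟨rfl, rfl⟩

/-- A partial tableau whose columns `C_1, …, C_{j-1}` contain two dots each, and whose rows
`R_1, …, R_{j-1}` are not empty. -/
structure Good (n j : ℕ) (T : Finset (ℕ × ℕ)) : Prop where
  le : j ≤ n + 1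
  mem : ∀ k r, (k, r) ∈ T → 1 ≤ k ∧ k ≤ n ∧ k ≤ r ∧ r ≤ 2 * n
  inj : ∀ k k' r, (k, r) ∈ T → (k', r) ∈ T → k = k'
  col : ∀ k, 1 ≤ k → k < j → (colDots T k).card = 2
  row : ∀ r, 1 ≤ r → r < j → ∃ k, (k, r) ∈ T

/-- The first boxes of the row `R_r`, up to the column `C_{j-1}`, are empty. -/
def Avail (n j : ℕ) (T : Finset (ℕ × ℕ)) (r : ℕ) : Prop :=
  1 ≤ r ∧ r ≤ 2 * n ∧ ∀ k < j, (k, r) ∉ T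

theorem Good.colOf (g : Good n j T) {k r : ℕ} (h : (k, r) ∈ T) : colOf T r = k := by
  have : rowDots T r = {k} := by
    ext k'
    rw [mem_rowDots, Finset.mem_singleton]
    exact ⟨fun h' => g.inj _ _ _ h' h, fun e => e ▸ h⟩
  simp [SymplecticDellac.colOf, this]

theorem Good.mono (g : Good n j T) {j' : ℕ} (h : j' ≤ j) : Good n j' T where
  le := h.trans g.le
  mem := g.mem
  inj := g.inj
  col k h1 h2 := g.col k h1 (by omega)
  row r h1 h2 := g.row r h1 (by omega)

theorem Good.le_of_avail (g : Good n j T) {r : ℕ} (h : Avail n j T r) : j ≤ r := by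
  by_contra hr
  obtain ⟨k, hk⟩ := g.row r h.1 (by omega)
  exact h.2.2 k (by have := g.mem _ _ hk; omega) hk

theorem Good.lower_upper (g : Good n j T) {k : ℕ} (h1 : 1 ≤ k) (h2 : k < j) :
    (k, lowerDot n T k) ∈ T ∧ (k, upperDot n T k) ∈ T ∧ lowerDot n T k ≠ upperDot n T k := by
  obtain ⟨a, b, hab, h⟩ := Finset.card_eq_two.1 (g.col k h1 h2)
  have ha : (k, a) ∈ T := mem_colDots.1 (by simp [h])
  have hb : (k, b) ∈ T := mem_colDots.1 (by simp [h])
  rcases lowerDot_upperDot h hab (g.mem _ _ ha).2.2.2 (g.mem _ _ hb).2.2.2 with ⟨e, e'⟩ | ⟨e, e'⟩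
  · rw [e, e']; exact ⟨ha, hb, hab⟩
  · rw [e, e']; exact ⟨hb, ha, hab.symm⟩

theorem pathStep_of_settled {i : ℕ} (h : Settled n j i) : pathStep n T j i = i := by
  simp [pathStep, h]

theorem Good.pathStep_cases (g : Good n j T) {i : ℕ} (h1 : 1 ≤ i) (h2 : i ≤ 2 * n)
    (h : ¬ Settled n j i) :
    (1 ≤ i ∧ i < j ∧ pathStep n T j i = lowerDot n T i) ∨
      (∃ k, i = n + k ∧ 1 ≤ k ∧ k < j ∧ pathStep n T j i = upperDot n T k) := by
  have := g.le
  by_cases hi : n < i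
  · right
    refine ⟨i - n, by omega, by omega, ?_, by simp [pathStep, h, hi]⟩
    unfold Settled at h; omega
  · left
    refine ⟨h1, ?_, by simp [pathStep, h, hi]⟩
    unfold Settled at h; omega

theorem Good.pathStep_mem (g : Good n j T) {i : ℕ} (h1 : 1 ≤ i) (h2 : i ≤ 2 * n)
    (h : ¬ Settled n j i) : ∃ k < j, (k, pathStep n T j i) ∈ T := by
  rcases g.pathStep_cases h1 h2 h with ⟨h3, h4, e⟩ | ⟨k, _, h3, h4, e⟩
  · exact ⟨i, h4, e ▸ (g.lower_upper h3 h4).1⟩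
  · exact ⟨k, h4, e ▸ (g.lower_upper h3 h4).2.1⟩

theorem Good.pathStep_range (g : Good n j T) {i : ℕ} (h1 : 1 ≤ i) (h2 : i ≤ 2 * n) :
    1 ≤ pathStep n T j i ∧ pathStep n T j i ≤ 2 * n := by
  by_cases h : Settled n j i
  · rw [pathStep_of_settled h]; exact ⟨h1, h2⟩
  · obtain ⟨k, _, hk⟩ := g.pathStep_mem h1 h2 h
    have := g.mem _ _ hk
    omega

/-- A dot of a column `C_k` with `k < j` has only one possible unsettled predecessor: `k` if it is
the lower dot, `n + k` if it is the upper one. -/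
theorem Good.pathStep_inj (g : Good n j T) {i i' : ℕ} (h1 : 1 ≤ i) (h2 : i ≤ 2 * n)
    (h : ¬ Settled n j i) (h1' : 1 ≤ i') (h2' : i' ≤ 2 * n) (h' : ¬ Settled n j i')
    (e : pathStep n T j i = pathStep n T j i') : i = i' := by
  rcases g.pathStep_cases h1 h2 h with ⟨h3, h4, e1⟩ | ⟨k, rfl, h3, h4, e1⟩ <;>
  rcases g.pathStep_cases h1' h2' h' with ⟨h3', h4', e2⟩ | ⟨k', rfl, h3', h4', e2⟩ <;>
  rw [e1, e2] at e
  · exact g.inj _ _ _ (g.lower_upper h3 h4).1 (e ▸ (g.lower_upper h3' h4').1)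
  · have := g.inj _ _ _ (g.lower_upper h3 h4).1 (e ▸ (g.lower_upper h3' h4').2.1)
    subst this
    exact absurd e (g.lower_upper h3 h4).2.2
  · have := g.inj _ _ _ (g.lower_upper h3 h4).2.1 (e ▸ (g.lower_upper h3' h4').1)
    subst this
    exact absurd e.symm (g.lower_upper h3 h4).2.2
  · rw [g.inj _ _ _ (g.lower_upper h3 h4).2.1 (e ▸ (g.lower_upper h3' h4').2.1)]

theorem Good.tPath_range (g : Good n j T) {i : ℕ} (h1 : 1 ≤ i) (h2 : i ≤ 2 * n) (k : ℕ) :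
    1 ≤ tPath n T j i k ∧ tPath n T j i k ≤ 2 * n := by
  induction k with
  | zero => exact ⟨h1, h2⟩
  | succ k ih =>
    rw [tPath, Function.iterate_succ_apply']
    exact g.pathStep_range ih.1 ih.2

theorem tPath_succ {i k : ℕ} : tPath n T j i (k + 1) = pathStep n T j (tPath n T j i k) := by
  rw [tPath, Function.iterate_succ_apply', tPath]

/-- Paths that meet are traced back through the injective steps. The trace cannot run past a start,
since every genuine step lands on a dot of `C_1, …, C_{j-1}` and an available row has none. The
indices need not agree, as settled paths stand still. -/
theorem tPath_inj (g : Good n j T) {r s : ℕ} (hr : Avail n j T r) (hs : Avail n j T s) :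
    ∀ a b : ℕ, tPath n T j r a = tPath n T j s b → r = s := by
  have key : ∀ {r s : ℕ}, Avail n j T r → Avail n j T s → ∀ b, r = tPath n T j s b → r = s := by
    intro r s hr hs b
    induction b with
    | zero => exact id
    | succ b ih =>
      intro e
      rw [tPath_succ] at e
      by_cases h : Settled n j (tPath n T j s b)
      · exact ih (by rwa [pathStep_of_settled h] at e)
      · have hb := g.tPath_range hs.1 hs.2.1 b
        obtain ⟨k, hk, hk'⟩ := g.pathStep_mem hb.1 hb.2 h
        exact absurd (e ▸ hk') (hr.2.2 k hk)
  intro a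
  induction a with
  | zero => exact key hr hs
  | succ a iha =>
    intro b
    induction b with
    | zero => exact fun e => (key hs hr _ e.symm).symm
    | succ b ihb =>
      intro e
      by_cases h : Settled n j (tPath n T j r a)
      · rw [tPath_succ, pathStep_of_settled h] at e
        exact iha _ e
      by_cases h' : Settled n j (tPath n T j s b)
      · rw [tPath_succ (i := s), pathStep_of_settled h'] at e
        exact ihb e
      have ha := g.tPath_range hr.1 hr.2.1 a
      have hb := g.tPath_range hs.1 hs.2.1 b
      rw [tPath_succ, tPath_succ] at e
      exact iha b (g.pathStep_inj ha.1 ha.2 h hb.1 hb.2 h' e)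

theorem Good.arrival_inj (g : Good n j T) {r s : ℕ} (hr : Avail n j T r) (hs : Avail n j T s)
    (e : arrival n T j r = arrival n T j s) : r = s := tPath_inj g hr hs _ _ e

theorem arrival_of_settled {i : ℕ} (h : Settled n j i) : arrival n T j i = i :=
  Function.iterate_fixed (pathStep_of_settled h) _

/-- An unsettled path never repeats a term, by the same tracing back to its start, and `2n + 1`
distinct terms do not fit into `[1, 2n]`. -/
theorem Good.arrival_settled (g : Good n j T) {r : ℕ} (hr : Avail n j T r) :
    Settled n j (arrival n T j r) := by
  by_contra hu
  have hall : ∀ k ≤ 2 * n, ¬ Settled n j (tPath n T j r k) := by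
    intro k hk h
    apply hu
    have : arrival n T j r = tPath n T j r k := by
      rw [arrival, show 2 * n = (2 * n - k) + k by omega, tPath, Function.iterate_add_apply]
      exact Function.iterate_fixed (pathStep_of_settled h) _
    rwa [this]
  have hinj : ∀ a b, a < b → b ≤ 2 * n → tPath n T j r a ≠ tPath n T j r b := by
    intro a
    induction a with
    | zero =>
      intro b hab hb e
      obtain ⟨b, rfl⟩ : ∃ c, b = c + 1 := ⟨b - 1, by omega⟩
      have hb' := g.tPath_range hr.1 hr.2.1 b
      rw [tPath_succ] at e
      obtain ⟨k, hk, hk'⟩ := g.pathStep_mem hb'.1 hb'.2 (hall b (by omega))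
      rw [← e] at hk'
      exact hr.2.2 k hk hk'
    | succ a ih =>
      intro b hab hb e
      obtain ⟨b, rfl⟩ : ∃ c, b = c + 1 := ⟨b - 1, by omega⟩
      rw [tPath_succ, tPath_succ] at e
      have ha' := g.tPath_range hr.1 hr.2.1 a
      have hb' := g.tPath_range hr.1 hr.2.1 b
      exact ih b (by omega) (by omega) (g.pathStep_inj ha'.1 ha'.2 (hall a (by omega))
        hb'.1 hb'.2 (hall b (by omega)) e)
  obtain ⟨a, ha, b, hb, hab, e⟩ := Finset.exists_ne_map_eq_of_card_lt_of_maps_to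
    (s := Finset.range (2 * n + 1)) (t := Finset.Icc 1 (2 * n)) (by simp)
    (f := tPath n T j r) (fun k _ => Finset.mem_Icc.2 (g.tPath_range hr.1 hr.2.1 k))
  rw [Finset.mem_range] at ha hb
  rcases lt_or_gt_of_ne hab with h | h
  · exact hinj a b h (by omega) e
  · exact hinj b a h (by omega) e.symm

/-- The rows with a dot in the columns `C_1, …, C_{j-1}`. -/
def usedRows (T : Finset (ℕ × ℕ)) (j : ℕ) : Finset ℕ := (Finset.Ico 1 j).biUnion (colDots T)

theorem Good.mem_usedRows (g : Good n j T) {r : ℕ} : r ∈ usedRows T j ↔ ∃ k < j, (k, r) ∈ T := by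
  simp only [usedRows, Finset.mem_biUnion, Finset.mem_Ico, mem_colDots]
  constructor
  · rintro ⟨k, hk, h⟩; exact ⟨k, hk.2, h⟩
  · rintro ⟨k, hk, h⟩; exact ⟨k, ⟨(g.mem _ _ h).1, hk⟩, h⟩

theorem Good.card_usedRows (g : Good n j T) : (usedRows T j).card = 2 * (j - 1) := by
  rw [usedRows, Finset.card_biUnion]
  · rw [Finset.sum_congr rfl (fun k hk => g.col k (Finset.mem_Ico.1 hk).1 (Finset.mem_Ico.1 hk).2)]
    simp [mul_comm]
  · intro k _ k' _ hkk
    rw [Function.onFun, Finset.disjoint_left]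
    intro r h h'
    exact hkk (g.inj _ _ _ (mem_colDots.1 h) (mem_colDots.1 h'))

theorem Good.usedRows_subset (g : Good n j T) : usedRows T j ⊆ Finset.Icc 1 (2 * n) := by
  intro r hr
  obtain ⟨k, _, hk⟩ := g.mem_usedRows.1 hr
  have := g.mem _ _ hk
  exact Finset.mem_Icc.2 ⟨by omega, by omega⟩

/-- Counting: the first `j - 1` columns occupy `2(j - 1)` rows, and the `2(n + 1 - j)` remaining
ones are as many as the settled values. -/
theorem Good.arrival_surj (g : Good n j T) (hj : 1 ≤ j) {x : ℕ} (hx : Settled n j x) :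
    ∃ r, Avail n j T r ∧ arrival n T j r = x := by
  have hle := g.le
  have hav : ∀ r ∈ Finset.Icc 1 (2 * n) \ usedRows T j, Avail n j T r := by
    intro r hr
    rw [Finset.mem_sdiff, Finset.mem_Icc, g.mem_usedRows] at hr
    push Not at hr
    exact ⟨hr.1.1, hr.1.2, hr.2⟩
  have hset : ∀ y, y ∈ Finset.Icc j n ∪ Finset.Icc (n + j) (2 * n) ↔ Settled n j y := by
    intro y; simp [Settled]
  have hcard : (Finset.Icc j n ∪ Finset.Icc (n + j) (2 * n)).card ≤
      (Finset.Icc 1 (2 * n) \ usedRows T j).card := by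
    rw [Finset.card_sdiff_of_subset g.usedRows_subset, g.card_usedRows]
    refine (Finset.card_union_le _ _).trans ?_
    simp only [Nat.card_Icc]
    omega
  obtain ⟨r, hr, e⟩ := Finset.surj_on_of_inj_on_of_card_le (s := Finset.Icc 1 (2 * n) \ usedRows T j)
    (t := Finset.Icc j n ∪ Finset.Icc (n + j) (2 * n)) (fun r _ => arrival n T j r)
    (fun r hr => (hset _).2 (g.arrival_settled (hav r hr)))
    (fun r s hr hs e => g.arrival_inj (hav r hr) (hav s hs) e) hcard x ((hset x).2 hx)
  exact ⟨r, hav r hr, e.symm⟩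

/-- This allows arrivals in the partial tableaux of the algorithm to be computed in the final
tableau. -/
theorem Good.arrival_congr (g : Good n j T) (h : ∀ k < j, ∀ r, (k, r) ∈ T ↔ (k, r) ∈ T') {r : ℕ}
    (h1 : 1 ≤ r) (h2 : r ≤ 2 * n) : arrival n T j r = arrival n T' j r := by
  have hc : ∀ k < j, colDots T k = colDots T' k := by
    intro k hk; ext r; rw [mem_colDots, mem_colDots, h k hk]
  have key : ∀ k, tPath n T j r k = tPath n T' j r k := by
    intro k
    induction k with
    | zero => rfl
    | succ k ih =>
      rw [tPath_succ, tPath_succ, ← ih]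
      by_cases hs : Settled n j (tPath n T j r k)
      · rw [pathStep_of_settled hs, pathStep_of_settled hs]
      have hk := g.tPath_range h1 h2 k
      have hle := g.le
      have hs' := hs
      unfold Settled at hs'
      unfold pathStep
      rw [if_neg hs, if_neg hs]
      split_ifs with hn
      · unfold upperDot; rw [hc _ (by omega)]
      · unfold lowerDot; rw [hc _ (by omega)]
  exact key _

/-! Tableaux. -/

theorem Good.of_mem_Tab (hT : T ∈ Tab n) : Good n (n + 1) T := by
  obtain ⟨h1, h2, h3⟩ := hT
  have hm : ∀ k r, (k, r) ∈ T → 1 ≤ k ∧ k ≤ n ∧ k ≤ r ∧ r ≤ 2 * n := by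
    intro k r h
    have := h1 _ h
    simp only [Finset.mem_Icc] at this
    obtain ⟨⟨a, b⟩, ⟨c, d⟩, e⟩ := this
    refine ⟨a, b, ?_, d⟩
    -- Rows with names beyond `n` lie above all column indices, so the line `y = x` only constrains
    -- rows whose level is their name.
    by_cases hr : r ≤ n
    · simpa [level, hr] using e
    · omega
  refine ⟨le_rfl, hm, ?_, ?_, ?_⟩
  · intro k k' r h h'
    have hk := hm _ _ h
    obtain ⟨c, hc⟩ := Finset.card_eq_one.1 (h2 r (Finset.mem_Icc.2 ⟨by omega, by omega⟩))
    have e1 : k ∈ rowDots T r := mem_rowDots.2 h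
    have e2 : k' ∈ rowDots T r := mem_rowDots.2 h'
    rw [hc, Finset.mem_singleton] at e1 e2
    rw [e1, e2]
  · intro k hk hk'
    exact h3 k (Finset.mem_Icc.2 ⟨hk, by omega⟩)
  · intro r hr hr'
    obtain ⟨c, hc⟩ := Finset.card_eq_one.1 (h2 r (Finset.mem_Icc.2 ⟨hr, by omega⟩))
    exact ⟨c, mem_rowDots.1 (by simp [hc])⟩

/-- The `n` columns contain `2n` dots in distinct rows, which therefore exhaust the rows. -/
theorem Good.exists_mem (g : Good n (n + 1) T) {r : ℕ} (h1 : 1 ≤ r) (h2 : r ≤ 2 * n) :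
    ∃ k, (k, r) ∈ T := by
  have : usedRows T (n + 1) = Finset.Icc 1 (2 * n) :=
    Finset.eq_of_subset_of_card_le g.usedRows_subset (by rw [g.card_usedRows]; simp)
  obtain ⟨k, _, hk⟩ := g.mem_usedRows.1 (this ▸ Finset.mem_Icc.2 ⟨h1, h2⟩)
  exact ⟨k, hk⟩

theorem Good.mem_Tab (g : Good n (n + 1) T) : T ∈ Tab n := by
  refine ⟨?_, ?_, ?_⟩
  · rintro ⟨k, r⟩ h
    have := g.mem _ _ h
    simp only [Finset.mem_Icc]
    refine ⟨by omega, by omega, ?_⟩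
    unfold level
    split_ifs <;> omega
  · intro r hr
    rw [Finset.mem_Icc] at hr
    obtain ⟨k, hk⟩ := g.exists_mem hr.1 hr.2
    rw [Finset.card_eq_one]
    refine ⟨k, ?_⟩
    ext k'
    rw [mem_rowDots, Finset.mem_singleton]
    exact ⟨fun h' => g.inj _ _ _ h' hk, fun e => e ▸ hk⟩
  · intro k hk
    rw [Finset.mem_Icc] at hk
    exact g.col k hk.1 (by omega)

theorem Good.colOf_mem (g : Good n (n + 1) T) {r : ℕ} (h1 : 1 ≤ r) (h2 : r ≤ 2 * n) :
    (SymplecticDellac.colOf T r, r) ∈ T := by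
  obtain ⟨k, hk⟩ := g.exists_mem h1 h2
  rwa [g.colOf hk]

theorem Good.avail (g : Good n (n + 1) T) {k r : ℕ} (h : (k, r) ∈ T) : Avail n k T r := by
  have := g.mem _ _ h
  refine ⟨by omega, by omega, fun k' hk' h' => ?_⟩
  have := g.inj _ _ _ h h'
  omega

end

/-! ### The pistol labeling and the map `φ` -/

section

variable {n j : ℕ} {T : Finset (ℕ × ℕ)}

theorem TypeLabel.ne_α {t : TypeLabel} : t ≠ TypeLabel.α ↔ t = TypeLabel.β := by
  cases t <;> simp

theorem ParityLabel.ne_o {p : ParityLabel} : p ≠ ParityLabel.o ↔ p = ParityLabel.e := by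
  cases p <;> simp

theorem Good.exists_other (g : Good n (n + 1) T) {r : ℕ} (h : (j, r) ∈ T) :
    ∃ s, r ≠ s ∧ colDots T j = {r, s} := by
  have := g.mem _ _ h
  obtain ⟨a, b, hab, e⟩ := Finset.card_eq_two.1 (g.col j (by omega) (by omega))
  have hr : r ∈ colDots T j := mem_colDots.2 h
  rw [e, Finset.mem_insert, Finset.mem_singleton] at hr
  rcases hr with rfl | rfl
  · exact ⟨b, hab, e⟩
  · exact ⟨a, hab.symm, by rw [e, Finset.pair_comm]⟩

theorem Good.otherDot_eq (g : Good n (n + 1) T) {r s : ℕ} (hrs : r ≠ s)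
    (h : colDots T j = {r, s}) : otherDot T r = s := by
  have hr : (j, r) ∈ T := mem_colDots.1 (by simp [h])
  simp [otherDot, g.colOf hr, h, hrs]

theorem Good.settled (g : Good n (n + 1) T) {r : ℕ} (h : (j, r) ∈ T) :
    Settled n j (arrival n T j r) :=
  (g.mono (by have := g.mem _ _ h; omega)).arrival_settled (g.avail h)

theorem Good.arrival_ne (g : Good n (n + 1) T) {r s : ℕ} (h : (j, r) ∈ T) (h' : (j, s) ∈ T)
    (hrs : r ≠ s) : arrival n T j r ≠ arrival n T j s := fun e =>
  hrs ((g.mono (by have := g.mem _ _ h; omega)).arrival_inj (g.avail h) (g.avail h') e)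

theorem Good.digit_spec (g : Good n (n + 1) T) {r : ℕ} (h : (j, r) ∈ T) :
    j + digitOf n T r ≤ n ∧ (arrival n T j r = j + digitOf n T r ∨
      arrival n T j r = n + (j + digitOf n T r)) := by
  have hs := g.settled h
  have hm := g.mem _ _ h
  unfold Settled at hs
  simp only [digitOf, g.colOf h]
  split_ifs <;> omega

theorem Good.digit_eq (g : Good n (n + 1) T) {r d : ℕ} (h : (j, r) ∈ T) (hd : j + d ≤ n)
    (h' : arrival n T j r = j + d ∨ arrival n T j r = n + (j + d)) : digitOf n T r = d := by
  have := g.digit_spec h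
  have := g.mem _ _ h
  omega

theorem typePos_congr {L L' : ℕ → PistolLabel} {r : ℕ}
    (h : ∀ s, (colOf T r + digitOf n T r, s) ∈ T → L s = L' s) :
    typePos n T L r = typePos n T L' r := by
  have h1 : HasBetaZeroEven T L (colOf T r + digitOf n T r) ↔
      HasBetaZeroEven T L' (colOf T r + digitOf n T r) := by
    unfold HasBetaZeroEven
    refine exists_congr fun s => and_congr_right fun hs => ?_
    rw [h s (mem_colDots.1 hs)]
  have h2 : SameType T L (colOf T r + digitOf n T r) ↔
      SameType T L' (colOf T r + digitOf n T r) := by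
    unfold SameType
    refine forall_congr' fun s => forall_congr' fun hs => forall_congr' fun s' =>
      forall_congr' fun hs' => ?_
    rw [h s (mem_colDots.1 hs), h s' (mem_colDots.1 hs')]
  simp only [typePos, h1, h2]

theorem Good.typeOf_congr (g : Good n (n + 1) T) {L L' : ℕ → PistolLabel} {r : ℕ}
    (hr : (j, r) ∈ T) (h : ∀ k > j, ∀ s, (k, s) ∈ T → L s = L' s) :
    typeOf n T L r = typeOf n T L' r := by
  obtain ⟨s, hrs, e⟩ := g.exists_other hr
  have hs : (j, s) ∈ T := mem_colDots.1 (by simp [e])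
  have key : ∀ r, (j, r) ∈ T → 0 < digitOf n T r → typePos n T L r = typePos n T L' r := by
    intro r hr hd
    refine typePos_congr fun s hs => h _ ?_ s hs
    rw [g.colOf hr]; omega
  simp only [typeOf, g.otherDot_eq hrs e]
  by_cases h1 : 0 < digitOf n T r
  · rw [if_pos h1, if_pos h1, key r hr h1]
  rw [if_neg h1, if_neg h1]
  by_cases h2 : digitOf n T s = 0
  · rw [if_pos h2, if_pos h2]
  · rw [key s hs (by omega)]

/-- The recursion becomes a fixed-point equation: a label is final once its column is processed, and
the rule for `C_j` only consults columns further right (`typeOf_congr`). -/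
theorem Good.pistolLabel_eq (g : Good n (n + 1) T) {r : ℕ} (hr : (j, r) ∈ T) :
    pistolLabel n T r = ⟨typeOf n T (pistolLabel n T) r, digitOf n T r,
      parityOf n T (pistolLabel n T) r⟩ := by
  have stable : ∀ k s, (k, s) ∈ T → ∀ m ≤ n, n - k < m →
      labelSteps n T m s = pistolLabel n T s := by
    intro k s hs m hm hk
    have hcol := g.colOf hs
    induction hm using Nat.decreasingInduction with
    | self => rfl
    | of_succ m hm ih =>
      rw [← ih (by omega)]
      exact (if_neg (by omega)).symm
  have hm := g.mem _ _ hr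
  obtain ⟨s, hrs, e⟩ := g.exists_other hr
  have hs : (j, s) ∈ T := mem_colDots.1 (by simp [e])
  have hc : ∀ k > j, ∀ s, (k, s) ∈ T →
      labelSteps n T (n - j) s = pistolLabel n T s := by
    intro k hk s hs
    have := g.mem _ _ hs
    exact stable k s hs _ (by omega) (by omega)
  rw [← stable j r hr (n - j + 1) (by omega) (by omega)]
  refine (if_pos (by rw [g.colOf hr]; omega)).trans ?_
  rw [g.typeOf_congr hr hc]
  congr 1
  simp only [parityOf, g.otherDot_eq hrs e, g.typeOf_congr hr hc, g.typeOf_congr hs hc]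

/-- The column `C_j` consists of the dots `d_r` and `d_s`. -/
structure Pair (T : Finset (ℕ × ℕ)) (j r s : ℕ) : Prop where
  ne : r ≠ s
  eq : colDots T j = {r, s}

namespace Pair

variable {r s : ℕ}

theorem left (p : Pair T j r s) : (j, r) ∈ T := mem_colDots.1 (by simp [p.eq])

theorem right (p : Pair T j r s) : (j, s) ∈ T := mem_colDots.1 (by simp [p.eq])

theorem symm (p : Pair T j r s) : Pair T j s r := ⟨p.ne.symm, by rw [p.eq, Finset.pair_comm]⟩

theorem eq_or (p : Pair T j r s) {i : ℕ} (h : (j, i) ∈ T) : i = r ∨ i = s := by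
  simpa [p.eq] using mem_colDots.2 h

theorem sameType_iff (p : Pair T j r s) {L : ℕ → PistolLabel} :
    SameType T L j ↔ (L r).type = (L s).type := by
  simp only [SameType, p.eq, Finset.mem_insert, Finset.mem_singleton, forall_eq_or_imp, forall_eq]
  tauto

theorem hasBeta_iff (p : Pair T j r s) {L : ℕ → PistolLabel} :
    HasBetaZeroEven T L j ↔ L r = ⟨TypeLabel.β, 0, ParityLabel.e⟩ ∨
      L s = ⟨TypeLabel.β, 0, ParityLabel.e⟩ := by
  simp [HasBetaZeroEven, p.eq]

theorem digit (g : Good n (n + 1) T) (p : Pair T j r s) :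
    (pistolLabel n T r).digit = digitOf n T r := by
  rw [g.pistolLabel_eq p.left]

theorem type_pos (g : Good n (n + 1) T) (p : Pair T j r s) (h : 0 < digitOf n T r) :
    (pistolLabel n T r).type = TypeLabel.α ↔
      if HasBetaZeroEven T (pistolLabel n T) (j + digitOf n T r) then
        arrival n T j r = j + digitOf n T r
      else (arrival n T j r = dmin n T (j + digitOf n T r) ↔
        ¬ SameType T (pistolLabel n T) (j + digitOf n T r)) := by
  rw [g.pistolLabel_eq p.left]
  simp only [typeOf, typePos, h, g.colOf p.left, if_true]
  split_ifs <;> simp_all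

theorem type_zero_zero (g : Good n (n + 1) T) (p : Pair T j r s) (h : digitOf n T r = 0)
    (h' : digitOf n T s = 0) : (pistolLabel n T r).type = TypeLabel.α ↔ arrival n T j r = j := by
  rw [g.pistolLabel_eq p.left]
  simp only [typeOf, h, h', g.colOf p.left, g.otherDot_eq p.ne p.eq]
  split_ifs <;> simp_all

theorem typePos_eq (g : Good n (n + 1) T) (p : Pair T j r s) (h : 0 < digitOf n T r) :
    typePos n T (pistolLabel n T) r = (pistolLabel n T r).type := by
  rw [g.pistolLabel_eq p.left]
  simp [typeOf, h]

theorem type_zero_α (g : Good n (n + 1) T) (p : Pair T j r s) (h : digitOf n T r = 0)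
    (h' : 0 < digitOf n T s) (hs : (pistolLabel n T s).type = TypeLabel.α) :
    (pistolLabel n T r).type = TypeLabel.α ↔ r ≠ arrival n T j r ∧ arrival n T j r = j := by
  rw [← typePos_eq g p.symm h'] at hs
  rw [g.pistolLabel_eq p.left]
  simp only [typeOf, h, h'.ne', g.colOf p.left, g.otherDot_eq p.ne p.eq, hs, lt_irrefl, if_false]
  split_ifs with h1
  · simpa using h1
  · simpa using h1

theorem type_zero_β (g : Good n (n + 1) T) (p : Pair T j r s) (h : digitOf n T r = 0)
    (h' : 0 < digitOf n T s) (hs : (pistolLabel n T s).type = TypeLabel.β) :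
    (pistolLabel n T r).type = TypeLabel.α ↔ arrival n T j r = dmin n T j := by
  rw [← typePos_eq g p.symm h'] at hs
  rw [g.pistolLabel_eq p.left]
  simp only [typeOf, h, h'.ne', g.colOf p.left, g.otherDot_eq p.ne p.eq, hs, lt_irrefl, if_false]
  split_ifs <;> simp_all

theorem parity_iff (g : Good n (n + 1) T) (p : Pair T j r s) :
    (pistolLabel n T r).parity = ParityLabel.o ↔
      ((pistolLabel n T r).type = TypeLabel.α ∧ (pistolLabel n T s).type = TypeLabel.β) ∨
      ((pistolLabel n T r).type = TypeLabel.α ∧ (pistolLabel n T s).type = TypeLabel.α ∧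
        digitOf n T s ≤ digitOf n T r) ∨
      ((pistolLabel n T r).type = TypeLabel.β ∧ (pistolLabel n T s).type = TypeLabel.β ∧
        digitOf n T r < digitOf n T s) := by
  rw [g.pistolLabel_eq p.left, g.pistolLabel_eq p.right]
  simp only [parityOf, g.otherDot_eq p.ne p.eq]
  cases typeOf n T (pistolLabel n T) r <;> cases typeOf n T (pistolLabel n T) s <;>
    simp

/-- With equal digital labels `h`, the two distinct arrivals are `j + h` and `n + j + h`, and every
branch of the type rule separates these. This is what makes the parity labels well defined. -/
theorem type_ne (g : Good n (n + 1) T) (p : Pair T j r s) (h : digitOf n T r = digitOf n T s) :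
    ¬ ((pistolLabel n T r).type = TypeLabel.α ↔ (pistolLabel n T s).type = TypeLabel.α) := by
  have hne := g.arrival_ne p.left p.right p.ne
  have h1 := g.digit_spec p.left
  have h2 := g.digit_spec p.right
  have hm := g.mem _ _ p.left
  by_cases h0 : digitOf n T r = 0
  · rw [type_zero_zero g p h0 (h ▸ h0), type_zero_zero g p.symm (h ▸ h0) h0]
    omega
  · rw [type_pos g p (by omega), type_pos g p.symm (by omega), ← h]
    rw [← h] at h2
    split_ifs with hb
    · omega
    · have : dmin n T (j + digitOf n T r) = j + digitOf n T r ∨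
          dmin n T (j + digitOf n T r) = n + (j + digitOf n T r) := by
        unfold dmin; split_ifs <;> simp
      have : arrival n T j s = dmin n T (j + digitOf n T r) ↔
          ¬ arrival n T j r = dmin n T (j + digitOf n T r) := by omega
      rw [this]
      tauto

theorem parity_ne (g : Good n (n + 1) T) (p : Pair T j r s) :
    ¬ ((pistolLabel n T r).parity = ParityLabel.o ↔
      (pistolLabel n T s).parity = ParityLabel.o) := by
  have h := type_ne g p
  rw [parity_iff g p, parity_iff g p.symm]
  rcases hr : (pistolLabel n T r).type with _ | _ <;>
  rcases hs : (pistolLabel n T s).type with _ | _ <;> simp [hr, hs] at h ⊢ <;> omega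

end Pair

/-- The column `C_j` consists of the odd dot `d_r` and of the even dot `d_s`. -/
structure OddEven (n : ℕ) (T : Finset (ℕ × ℕ)) (j r s : ℕ) : Prop extends Pair T j r s where
  odd : (pistolLabel n T r).parity = ParityLabel.o
  even : (pistolLabel n T s).parity = ParityLabel.e

theorem Good.exists_oddEven (g : Good n (n + 1) T) (h1 : 1 ≤ j) (h2 : j ≤ n) :
    ∃ r s, OddEven n T j r s := by
  obtain ⟨a, b, hab, e⟩ := Finset.card_eq_two.1 (g.col j h1 (by omega))
  have p : Pair T j a b := ⟨hab, e⟩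
  have := p.parity_ne g
  by_cases h : (pistolLabel n T a).parity = ParityLabel.o
  · exact ⟨a, b, p, h, ParityLabel.ne_o.1 (by tauto)⟩
  · exact ⟨b, a, p.symm, by tauto, ParityLabel.ne_o.1 h⟩

namespace OddEven

variable {r s : ℕ}

theorem parityDot_o (q : OddEven n T j r s) : parityDot n T ParityLabel.o j = r := by
  simp [parityDot, q.eq, Finset.filter_insert, Finset.filter_singleton, q.odd, q.even]

theorem parityDot_e (q : OddEven n T j r s) : parityDot n T ParityLabel.e j = s := by
  simp [parityDot, q.eq, Finset.filter_insert, Finset.filter_singleton, q.odd, q.even]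

theorem phi_odd (g : Good n (n + 1) T) (q : OddEven n T j r s) :
    phi n T (2 * j - 1) = 2 * (j + digitOf n T r) := by
  have := g.mem _ _ q.left
  have e : (2 * j - 1 + 1) / 2 = j := by omega
  simp only [phi, e, q.parityDot_o, q.digit g]
  rw [if_pos (by rw [Finset.mem_Icc]; omega), if_pos (by omega)]

theorem phi_even (g : Good n (n + 1) T) (q : OddEven n T j r s) :
    phi n T (2 * j) = if (pistolLabel n T s).type = TypeLabel.α ∧ digitOf n T s = 0 then
      2 * (j + digitOf n T r) else 2 * (j + digitOf n T s) := by
  have := g.mem _ _ q.left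
  have e : (2 * j + 1) / 2 = j := by omega
  simp only [phi, e, q.parityDot_o, q.parityDot_e, q.digit g, q.symm.digit g]
  rw [if_pos (by rw [Finset.mem_Icc]; omega), if_neg (by omega)]

theorem hasBeta_iff (g : Good n (n + 1) T) (q : OddEven n T j r s) :
    HasBetaZeroEven T (pistolLabel n T) j ↔
      (pistolLabel n T s).type = TypeLabel.β ∧ digitOf n T s = 0 := by
  rw [q.toPair.hasBeta_iff, ← q.symm.digit g]
  have h1 := q.odd
  have h2 := q.even
  rcases hr : pistolLabel n T r with ⟨a, b, c⟩
  rcases hs : pistolLabel n T s with ⟨a', b', c'⟩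
  rw [hr] at h1
  rw [hs] at h2
  simp_all

/-- The value `2j` could otherwise come only from an even dot `α_0` with `h_o = 0`. An even dot of
type `α` forces the odd one to have type `α`, and equal types exclude equal digital labels. -/
theorem phi_eq_iff (g : Good n (n + 1) T) (q : OddEven n T j r s) :
    phi n T (2 * j) = 2 * j ↔ HasBetaZeroEven T (pistolLabel n T) j := by
  rw [q.hasBeta_iff g, q.phi_even g]
  have h := (q.parity_iff g).1 q.odd
  have hne := q.type_ne g
  rcases hr : (pistolLabel n T r).type with _ | _ <;>
  rcases hs : (pistolLabel n T s).type with _ | _ <;> simp_all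
  all_goals split_ifs <;> omega

end OddEven

theorem phi_mem_SP (hT : T ∈ Tab n) : phi n T ∈ SP n := by
  have g := Good.of_mem_Tab hT
  have val : ∀ k, 1 ≤ k → k ≤ 2 * n → k ≤ phi n T k ∧ ∃ i, 1 ≤ i ∧ i ≤ n ∧ phi n T k = 2 * i := by
    intro k h1 h2
    obtain ⟨r, s, q⟩ := g.exists_oddEven (j := (k + 1) / 2) (by omega) (by omega)
    have e1 := g.digit_spec q.left
    have e2 := g.digit_spec q.right
    rcases Nat.even_or_odd k with h | h
    · have : k = 2 * ((k + 1) / 2) := by obtain ⟨c, rfl⟩ := h; omega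
      have hp := q.phi_even g
      rw [← this] at hp
      rw [hp]
      split_ifs
      · exact ⟨by omega, _, by omega, e1.1, rfl⟩
      · exact ⟨by omega, _, by omega, e2.1, rfl⟩
    · have : k = 2 * ((k + 1) / 2) - 1 := by obtain ⟨c, rfl⟩ := h; omega
      have hp := q.phi_odd g
      rw [← this] at hp
      rw [hp]
      exact ⟨by omega, _, by omega, e1.1, rfl⟩
  refine ⟨?_, ?_, fun k hk => (val k hk.1 hk.2).1⟩
  · intro k hk
    simp only [phi]
    rw [if_neg]
    simpa using hk
  · ext m
    constructor
    · rintro ⟨k, hk, rfl⟩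
      obtain ⟨_, i, h1, h2, h3⟩ := val k hk.1 hk.2
      exact ⟨i, ⟨h1, h2⟩, h3⟩
    · rintro ⟨i, ⟨h1, h2⟩, rfl⟩
      -- The column of `d_i` produces the value `2i`: the path from this dot is constant, so its
      -- digital label is `i - j`.
      obtain ⟨j, hj⟩ := g.exists_mem h1 (by omega)
      have hm := g.mem _ _ hj
      have harr : arrival n T j i = i := arrival_of_settled (by unfold Settled; omega)
      have hd : digitOf n T i = i - j := g.digit_eq hj (by omega) (by omega)
      obtain ⟨r, s, q⟩ := g.exists_oddEven (j := j) (by omega) (by omega)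
      rcases q.eq_or hj with rfl | rfl
      · exact ⟨2 * j - 1, ⟨by omega, by omega⟩, by rw [q.phi_odd g, hd]; omega⟩
      · refine ⟨2 * j, ⟨by omega, by omega⟩, ?_⟩
        rw [q.phi_even g]
        have hpar := (q.parity_iff g).1 q.odd
        split_ifs with hc
        -- The even dot is `d_j` with label `α_0`, so the odd dot has type `α`. If the latter had a
        -- positive digital label, `d_j`, being its own arrival, would have type `β`.
        · have hi : i = j := by omega
          by_cases h0 : digitOf n T r = 0
          · omega
          · rcases ht : (pistolLabel n T r).type with _ | _
            · have := (q.symm.type_zero_α g hc.2 (by omega) ht).1 hc.1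
              omega
            · simp_all
        · omega

end

/-! ### The insertion rule and its static description -/

section

variable {n j : ℕ} {f : ℕ → ℕ} {T : Finset (ℕ × ℕ)}

/-- The row name `i` such that a dot labeled with `l` at the height `h` is inserted into the box
`C_j ∩ R_i`. -/
def insertionRow (n : ℕ) (f : ℕ → ℕ) (j : ℕ) (U : LabeledTableau) (l : InsLabel) (h : ℕ) : ℕ :=
  if h = 0 then
    if rowDots U.dots j = ∅ ∨ l = InsLabel.a then j else n + j
  else
    if rowDots U.dots (j + h) = ∅ then
      if l = InsLabel.b ∧ f (2 * (j + h)) = 2 * (j + h) then n + (j + h) else j + h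
    else if l = U.lab (j + h) then j + h
    else n + (j + h)

theorem insertAt_eq {U : LabeledTableau} {l : InsLabel} {h : ℕ} :
    insertAt n f j U l h = insertBox n j U l (insertionRow n f j U l h) := by
  simp only [insertAt, insertionRow, Nat.add_eq_left]
  cases l <;> split_ifs <;> simp_all

theorem insertionRow_eq_or {U : LabeledTableau} {l : InsLabel} {h : ℕ} :
    insertionRow n f j U l h = j + h ∨ insertionRow n f j U l h = n + (j + h) := by
  unfold insertionRow
  split_ifs <;> simp_all

theorem settled_insertionRow {U : LabeledTableau} {l : InsLabel} {h : ℕ} (hh : j + h ≤ n) :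
    Settled n j (insertionRow n f j U l h) := by
  have := insertionRow_eq_or (n := n) (f := f) (j := j) (U := U) (l := l) (h := h)
  unfold Settled
  omega

/-- Injectivity of `π_j` reduces the set of candidate rows to a singleton. -/
theorem Good.insertBox_eq {U : LabeledTableau} (g : Good n j U.dots) {l : InsLabel} {r x : ℕ}
    (hr : Avail n (j + 1) U.dots r) (hx : arrival n U.dots j r = x) :
    insertBox n j U l x = ⟨insert (j, r) U.dots, Function.update U.lab r l⟩ := by
  have hav : ∀ s, Avail n (j + 1) U.dots s → Avail n j U.dots s := fun s hs =>
    ⟨hs.1, hs.2.1, fun k hk => hs.2.2 k (by omega)⟩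
  have e : insertionRows n U.dots j x = {r} := by
    ext s
    simp only [insertionRows, Finset.mem_filter, Finset.mem_Icc, mem_rowDots, Finset.mem_singleton]
    constructor
    · rintro ⟨⟨h1, h2⟩, h3, h4⟩
      have hs : Avail n (j + 1) U.dots s := by
        refine ⟨?_, h2, fun k hk h => ?_⟩
        -- The name `0` is a candidate only for `j = 0`; then every name is settled, and `0` cannot
        -- be the arrival from `r ≥ 1`.
        · by_contra h0
          obtain rfl : s = 0 := by omega
          obtain rfl : j = 0 := by omega
          have h1 := g.arrival_settled (hav r hr)
          rw [hx, ← h4] at h1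
          have h5 : ∀ k, tPath n U.dots 0 0 k = 0 := fun k =>
            Function.iterate_fixed (pathStep_of_settled (by unfold Settled; omega)) k
          have h6 : ¬ arrival n U.dots 0 r = 0 := by
            rw [arrival_of_settled (by unfold Settled; have := hr.2.1; omega)]
            have := hr.1; omega
          exact h6 (by rw [hx, ← h4]; exact h5 _)
        · have := h3 k h
          omega
      exact g.arrival_inj (hav s hs) (hav r hr) (h4.trans hx.symm)
    · rintro rfl
      exact ⟨⟨g.le_of_avail (hav s hr), hr.2.1⟩, fun k hk => by
        by_contra h; exact hr.2.2 k (by omega) hk, hx⟩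
  simp only [insertBox, e, Finset.image_singleton, Finset.mem_singleton]
  rw [Finset.union_comm, ← Finset.insert_eq]
  congr 1
  ext s
  simp [Function.update_apply]

/-- The dots of the columns `C_1, …, C_{j-1}`. -/
def cut (T : Finset (ℕ × ℕ)) (j : ℕ) : Finset (ℕ × ℕ) := T.filter (fun b => b.1 < j)

theorem mem_cut {k r : ℕ} : (k, r) ∈ cut T j ↔ (k, r) ∈ T ∧ k < j := by
  simp [cut]

theorem Good.cut (g : Good n (n + 1) T) (hj : j ≤ n + 1) : Good n j (cut T j) where
  le := hj
  mem k r h := g.mem k r (mem_cut.1 h).1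
  inj k k' r h h' := g.inj k k' r (mem_cut.1 h).1 (mem_cut.1 h').1
  col k h1 h2 := by
    rw [← g.col k h1 (by omega)]
    congr 1
    ext r
    simp [mem_colDots, mem_cut, h2]
  row r h1 h2 := by
    obtain ⟨k, hk⟩ := g.row r h1 (by omega)
    exact ⟨k, mem_cut.2 ⟨hk, by have := g.mem _ _ hk; omega⟩⟩

/-- The dot `d_t` of `C_j`, with the label `L t`, is inserted at the height `h` into the partial
tableau `V`, which contains the columns `C_1, …, C_{j-1}` of `T` and possibly the other dot of
`C_j`. -/
structure Placed (n : ℕ) (f : ℕ → ℕ) (T : Finset (ℕ × ℕ)) (L : ℕ → InsLabel) (j : ℕ)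
    (V : Finset (ℕ × ℕ)) (t h : ℕ) : Prop where
  sub : ∀ k i, (k, i) ∈ V → (k, i) ∈ T ∧ k ≤ j
  sup : ∀ k i, (k, i) ∈ T → k < j → (k, i) ∈ V
  mem : (j, t) ∈ T
  notMem : (j, t) ∉ V
  le : j + h ≤ n
  arr : arrival n T j t = insertionRow n f j ⟨V, L⟩ (L t) h

namespace Placed

variable {L : ℕ → InsLabel} {V : Finset (ℕ × ℕ)} {t h : ℕ}

theorem avail (P : Placed n f T L j V t h) (g : Good n j T) : Avail n j T t := by
  have := g.mem _ _ P.mem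
  refine ⟨by omega, by omega, fun k hk hk' => ?_⟩
  have := g.inj _ _ _ P.mem hk'
  omega

theorem avail_of_empty (P : Placed n f T L j V t h) {i : ℕ} (h1 : 1 ≤ i) (h2 : i ≤ n)
    (he : rowDots V i = ∅) : Avail n j T i :=
  ⟨h1, by omega, fun k hk hk' => (rowDots_eq_empty.1 he) k (P.sup k i hk' hk)⟩

theorem eq_of_arrival (P : Placed n f T L j V t h) (g : Good n j T) {i : ℕ} (h1 : 1 ≤ i)
    (hj : j ≤ i) (h2 : i ≤ n) (he : rowDots V i = ∅) (ha : arrival n T j t = i) : t = i :=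
  g.arrival_inj (P.avail g) (P.avail_of_empty h1 h2 he)
    (ha.trans (arrival_of_settled (by unfold Settled; omega)).symm)

theorem empty (P : Placed n f T L j V t h) (g : Good n j T) : rowDots V t = ∅ := by
  rw [rowDots_eq_empty]
  intro k hk
  have := g.inj _ _ _ P.mem (P.sub _ _ hk).1
  subst this
  exact P.notMem hk

/-- The settled row `R_t` is its own arrival and was empty, so the rule chose `R_t`; for the label
`b` and `f(2t) = 2t` it would have chosen `R_{n+t}`. -/
theorem f_ne (P : Placed n f T L j V t h) (g : Good n j T) (hj : j < t) (ht : t ≤ n)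
    (hl : L t = InsLabel.b) : f (2 * t) ≠ 2 * t := by
  intro hf
  have hm := g.mem _ _ P.mem
  have ha := P.arr
  rw [arrival_of_settled (by unfold Settled; omega)] at ha
  have hle := P.le
  have hor := insertionRow_eq_or (n := n) (f := f) (j := j) (U := ⟨V, L⟩) (l := L t) (h := h)
  have hth : t = j + h := by omega
  unfold insertionRow at ha
  rw [if_neg (by omega), ← hth, if_pos (P.empty g), if_pos ⟨hl, hf⟩] at ha
  omega

/-- Unless `f(2i) = 2i`, the rule never chooses `R_{n+i}` while `R_i` is empty. This is the origin
of condition (a). -/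
theorem exists_twin (P : Placed n f T L j V t h) (g : Good n j T) {i : ℕ} (hj : j ≤ i)
    (hi : i ≤ n) (ht : t = n + i) (hf : f (2 * i) ≠ 2 * i) : ∃ k ≤ j, (k, i) ∈ T := by
  by_contra hc
  push Not at hc
  have hm := g.mem _ _ P.mem
  have he : rowDots V i = ∅ := by
    rw [rowDots_eq_empty]
    intro k hk
    exact hc k (P.sub _ _ hk).2 (P.sub _ _ hk).1
  have ha := P.arr
  rw [arrival_of_settled (by unfold Settled; omega)] at ha
  have hle := P.le
  have hor := insertionRow_eq_or (n := n) (f := f) (j := j) (U := ⟨V, L⟩) (l := L t) (h := h)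
  obtain rfl : i = j + h := by omega
  unfold insertionRow at ha
  split_ifs at ha with h1 h2
  · omega
  · simp_all
  · tauto
  · omega

theorem filled (P : Placed n f T L j V t h) (g : Good n j T) (hh : 0 < h)
    (hf : f (2 * (j + h)) ≠ 2 * (j + h)) : ∃ k ≤ j, (k, j + h) ∈ T := by
  by_cases he : rowDots V (j + h) = ∅
  · have hm := g.mem _ _ P.mem
    have ha := P.arr
    unfold insertionRow at ha
    rw [if_neg hh.ne', if_pos he, if_neg (fun h' => hf h'.2)] at ha
    rw [← P.eq_of_arrival g (by omega) (by omega) P.le he ha]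
    exact ⟨j, le_rfl, P.mem⟩
  · rw [rowDots_eq_empty] at he
    push Not at he
    obtain ⟨k, hk⟩ := he
    exact ⟨k, (P.sub _ _ hk).2, (P.sub _ _ hk).1⟩

/-- By `hb`, a dot already present in `R_{j+h}` carries `a`, so the label `a` selects `R_{j+h}`
whether this row is empty or not. -/
theorem label_iff_of_eq (P : Placed n f T L j V t h) (hh : 0 < h)
    (hf : f (2 * (j + h)) = 2 * (j + h))
    (hb : ∀ k < j + h, (k, j + h) ∈ T → L (j + h) = InsLabel.a) :
    L t = InsLabel.a ↔ arrival n T j t = j + h := by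
  have hn := P.le
  have hn0 : n ≠ 0 := by omega
  rw [P.arr]
  unfold insertionRow
  rw [if_neg hh.ne']
  split_ifs with h1 h2 h2
  · simp [h2.1, hn0]
  · simp only [hf, and_true] at h2
    cases hl : L t <;> simp_all
  all_goals
    rw [rowDots_eq_empty] at h1
    push Not at h1
    obtain ⟨k, hk⟩ := h1
    have := hb k (by have := (P.sub _ _ hk).2; omega) (P.sub _ _ hk).1
    simp_all

/-- If `R_{j+h}` was empty, the inserted dot is `d_{j+h}` itself and both sides hold; otherwise this
is the comparison of labels in the rule. -/
theorem label_iff_of_ne (P : Placed n f T L j V t h) (g : Good n j T) (hh : 0 < h)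
    (hf : f (2 * (j + h)) ≠ 2 * (j + h)) :
    L t = L (j + h) ↔ arrival n T j t = j + h := by
  have hm := g.mem _ _ P.mem
  have ha := P.arr
  unfold insertionRow at ha
  rw [if_neg hh.ne'] at ha
  split_ifs at ha with h1 h2 h2
  · exact absurd h2.2 hf
  · rw [P.eq_of_arrival g (by omega) (by omega) P.le h1 ha]
    simp only [true_iff]
    exact arrival_of_settled (by have := P.le; unfold Settled; omega)
  · simp_all
  · have : n ≠ 0 := by omega
    simp_all

theorem arrival_zero_iff (P : Placed n f T L j V t 0) (g : Good n j T) :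
    arrival n T j t = j ↔ rowDots V j = ∅ ∨ L t = InsLabel.a := by
  have hm := g.mem _ _ P.mem
  rw [P.arr]
  unfold insertionRow
  rw [if_pos rfl]
  split_ifs with h1
  · simpa using h1
  · constructor
    · intro; omega
    · intro h; exact absurd h h1

end Placed

/-- The dots `d_r` and `d_s` of `C_j` are the odd dot and the even dot obtained in the step `j` of
the construction of `Φ(f)`, with the labels given by `L`. -/
structure StepSpec (n : ℕ) (f : ℕ → ℕ) (T : Finset (ℕ × ℕ)) (L : ℕ → InsLabel) (j r s : ℕ) : Prop
    extends Pair T j r s where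
  labels : stepLabels f j ⟨cut T j, L⟩ = (L r, L s)
  odd : arrival n T j r = insertionRow n f j ⟨cut T j, L⟩ (L r) (stepHeights f j ⟨cut T j, L⟩).1
  even : arrival n T j s = insertionRow n f j ⟨insert (j, r) (cut T j), L⟩ (L s)
    (stepHeights f j ⟨cut T j, L⟩).2

theorem SP.even_value (hf : f ∈ SP n) {k : ℕ} (h1 : 1 ≤ k) (h2 : k ≤ 2 * n) :
    k ≤ f k ∧ f k % 2 = 0 ∧ f k ≤ 2 * n := by
  have h3 : f k ∈ f '' Set.Icc 1 (2 * n) := ⟨k, ⟨h1, h2⟩, rfl⟩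
  rw [hf.2.1] at h3
  obtain ⟨i, hi, e⟩ := h3
  have := hi.2
  exact ⟨hf.2.2 k ⟨h1, h2⟩, by omega, by omega⟩

theorem stepHeights_le (hf : f ∈ SP n) (h1 : 1 ≤ j) (h2 : j ≤ n) {U : LabeledTableau} :
    j + (stepHeights f j U).1 ≤ n ∧ j + (stepHeights f j U).2 ≤ n := by
  have e1 := SP.even_value hf (k := 2 * j - 1) (by omega) (by omega)
  have e2 := SP.even_value hf (k := 2 * j) (by omega) (by omega)
  simp only [stepHeights]
  split_ifs <;> omega

namespace StepSpec

variable {L : ℕ → InsLabel} {r s : ℕ}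

theorem placed_odd (S : StepSpec n f T L j r s) (hf : f ∈ SP n) (h1 : 1 ≤ j) (h2 : j ≤ n) :
    Placed n f T L j (cut T j) r (stepHeights f j ⟨cut T j, L⟩).1 where
  sub _ _ h := ⟨(mem_cut.1 h).1, (mem_cut.1 h).2.le⟩
  sup _ _ h h' := mem_cut.2 ⟨h, h'⟩
  mem := S.left
  notMem h := lt_irrefl _ (mem_cut.1 h).2
  le := (stepHeights_le hf h1 h2).1
  arr := S.odd

theorem placed_even (S : StepSpec n f T L j r s) (hf : f ∈ SP n) (h1 : 1 ≤ j) (h2 : j ≤ n) :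
    Placed n f T L j (insert (j, r) (cut T j)) s (stepHeights f j ⟨cut T j, L⟩).2 where
  sub k i h := by
    rcases Finset.mem_insert.1 h with h | h
    · obtain ⟨rfl, rfl⟩ := Prod.mk.inj h
      exact ⟨S.left, le_rfl⟩
    · exact ⟨(mem_cut.1 h).1, (mem_cut.1 h).2.le⟩
  sup _ _ h h' := Finset.mem_insert_of_mem (mem_cut.2 ⟨h, h'⟩)
  mem := S.right
  notMem h := by
    rcases Finset.mem_insert.1 h with h | h
    · exact S.ne (Prod.mk.inj h).2.symm
    · exact lt_irrefl _ (mem_cut.1 h).2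
  le := (stepHeights_le hf h1 h2).2
  arr := S.even

theorem placed (S : StepSpec n f T L j r s) (hf : f ∈ SP n) (h1 : 1 ≤ j) (h2 : j ≤ n) {t : ℕ}
    (ht : (j, t) ∈ T) : ∃ V h, Placed n f T L j V t h := by
  rcases S.eq_or ht with rfl | rfl
  · exact ⟨_, _, S.placed_odd hf h1 h2⟩
  · exact ⟨_, _, S.placed_even hf h1 h2⟩

end StepSpec

/-- The columns `C_1, …, C_m` of `T` are obtained in the steps `1, …, m` of the construction of
`Φ(f)`. -/
def Spec (n : ℕ) (f : ℕ → ℕ) (m : ℕ) (T : Finset (ℕ × ℕ)) (L : ℕ → InsLabel) : Prop :=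
  ∀ j, 1 ≤ j → j ≤ m → ∃ r s, StepSpec n f T L j r s

namespace Spec

variable {m : ℕ} {L : ℕ → InsLabel}

theorem f_ne (S : Spec n f m T L) (hf : f ∈ SP n) (g : Good n (m + 1) T) {k i : ℕ} (hk : k ≤ m)
    (hi : (k, i) ∈ T) (hki : k < i) (hin : i ≤ n) (hl : L i = InsLabel.b) :
    f (2 * i) ≠ 2 * i := by
  have hm := g.mem _ _ hi
  obtain ⟨r, s, Q⟩ := S k hm.1 hk
  obtain ⟨V, h, P⟩ := Q.placed hf hm.1 hm.2.1 hi
  exact P.f_ne (g.mono (by omega)) hki hin hl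

/-- Here surjectivity of `f` enters: the value `2(m + 1)` must be taken at some `k ≤ 2m`, and the
corresponding step fills `R_{m+1}` if it is still empty. -/
theorem filled (S : Spec n f m T L) (hf : f ∈ SP n) (g : Good n (m + 1) T)
    (hmn : m + 1 ≤ n) (h1 : f (2 * (m + 1) - 1) ≠ 2 * (m + 1))
    (h2 : f (2 * (m + 1)) ≠ 2 * (m + 1)) : ∃ k, (k, m + 1) ∈ T := by
  have : 2 * (m + 1) ∈ f '' Set.Icc 1 (2 * n) := by
    rw [hf.2.1]; exact ⟨m + 1, ⟨by omega, hmn⟩, rfl⟩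
  obtain ⟨k, ⟨hk1, hk2⟩, e⟩ := this
  have hk := SP.even_value hf hk1 hk2
  have hkm : k ≤ 2 * m := by
    by_contra hc
    have : k = 2 * (m + 1) - 1 ∨ k = 2 * (m + 1) := by omega
    rcases this with rfl | rfl
    · exact h1 e
    · exact h2 e
  obtain ⟨c, hc1, hc2, hc⟩ : ∃ c, 1 ≤ c ∧ c ≤ m ∧ (k = 2 * c - 1 ∨ k = 2 * c) :=
    ⟨(k + 1) / 2, by omega, by omega, by omega⟩
  obtain ⟨r, s, Q⟩ := S c hc1 hc2
  have hh : c + (stepHeights f c ⟨SymplecticDellac.cut T c, L⟩).1 = m + 1 ∨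
      c + (stepHeights f c ⟨SymplecticDellac.cut T c, L⟩).2 = m + 1 := by
    simp only [stepHeights]
    rcases hc with rfl | rfl
    · left; omega
    -- When the even height is reset to `0`, one has `δ_o = δ_e`, and the odd dot realizes the value
    -- instead.
    · split_ifs with hs
      · left; omega
      · right; omega
  rcases hh with hh | hh
  · obtain ⟨k, _, hk⟩ := (Q.placed_odd hf hc1 (by omega)).filled (g.mono (by omega)) (by omega)
      (by rw [hh]; exact h2)
    exact ⟨k, hh ▸ hk⟩
  · obtain ⟨k, _, hk⟩ := (Q.placed_even hf hc1 (by omega)).filled (g.mono (by omega)) (by omega)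
      (by rw [hh]; exact h2)
    exact ⟨k, hh ▸ hk⟩

end Spec

end

/-! ### The algorithm satisfies its description and is determined by it -/

section

variable {n j : ℕ} {f : ℕ → ℕ} {T T' V : Finset (ℕ × ℕ)} {L L' : ℕ → InsLabel}

theorem insertionRow_congr (hL : ∀ k r, (k, r) ∈ V → L r = L' r) {l : InsLabel} {h : ℕ} :
    insertionRow n f j ⟨V, L⟩ l h = insertionRow n f j ⟨V, L'⟩ l h := by
  unfold insertionRow
  by_cases he : rowDots V (j + h) = ∅
  · simp only [he, if_true]
  · rw [rowDots_eq_empty] at he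
    push Not at he
    obtain ⟨k, hk⟩ := he
    simp only [hL k _ hk]

theorem stepLabels_congr (hL : ∀ k r, (k, r) ∈ V → L r = L' r) :
    stepLabels f j ⟨V, L⟩ = stepLabels f j ⟨V, L'⟩ := by
  unfold stepLabels
  by_cases he : rowDots V j = ∅
  · simp only [he, if_true]
  · rw [rowDots_eq_empty] at he
    push Not at he
    obtain ⟨k, hk⟩ := he
    simp only [hL k _ hk]

theorem stepHeights_congr (hL : ∀ k r, (k, r) ∈ V → L r = L' r) :
    stepHeights f j ⟨V, L⟩ = stepHeights f j ⟨V, L'⟩ := by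
  simp only [stepHeights, stepLabels_congr hL]

theorem StepSpec.congr (g : Good n j T) (hT : ∀ k ≤ j, ∀ r, (k, r) ∈ T ↔ (k, r) ∈ T')
    (hL : ∀ k ≤ j, ∀ r, (k, r) ∈ T → L r = L' r) {r s : ℕ} (S : StepSpec n f T L j r s) :
    StepSpec n f T' L' j r s := by
  have hcut : cut T' j = cut T j := by
    ext ⟨k, i⟩
    rw [mem_cut, mem_cut]
    constructor
    · rintro ⟨h1, h2⟩; exact ⟨(hT k h2.le i).2 h1, h2⟩
    · rintro ⟨h1, h2⟩; exact ⟨(hT k h2.le i).1 h1, h2⟩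
  have hLc : ∀ k i, (k, i) ∈ cut T j → L i = L' i := fun k i h =>
    hL k (mem_cut.1 h).2.le i (mem_cut.1 h).1
  have hLc' : ∀ k i, (k, i) ∈ insert (j, r) (cut T j) → L i = L' i := by
    intro k i h
    rcases Finset.mem_insert.1 h with h | h
    · obtain ⟨rfl, rfl⟩ := Prod.mk.inj h
      exact hL _ le_rfl _ S.left
    · exact hLc k i h
  have hr := g.mem _ _ S.left
  have hs := g.mem _ _ S.right
  refine ⟨⟨S.ne, ?_⟩, ?_, ?_, ?_⟩
  · rw [← S.eq]; ext i; rw [mem_colDots, mem_colDots, hT j le_rfl]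
  · rw [hcut, ← stepLabels_congr hLc, S.labels, hL _ le_rfl _ S.left, hL _ le_rfl _ S.right]
  · rw [hcut, ← stepHeights_congr hLc, ← insertionRow_congr hLc, ← hL _ le_rfl _ S.left, ← S.odd]
    exact (g.arrival_congr (fun k hk => hT k hk.le) (by omega) (by omega)).symm
  · rw [hcut, ← stepHeights_congr hLc, ← insertionRow_congr hLc', ← hL _ le_rfl _ S.right, ← S.even]
    exact (g.arrival_congr (fun k hk => hT k hk.le) (by omega) (by omega)).symm

theorem stepLabels_cases (f : ℕ → ℕ) (j : ℕ) (U : LabeledTableau) :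
    ((rowDots U.dots j = ∅ ∨ U.lab j = InsLabel.a) ∧ stepLabels f j U = (InsLabel.a, InsLabel.b)) ∨
    (rowDots U.dots j ≠ ∅ ∧ U.lab j = InsLabel.b ∧
      ((f (2 * j - 1) / 2 - j < f (2 * j) / 2 - j ∧ stepLabels f j U = (InsLabel.b, InsLabel.b)) ∨
      (f (2 * j) / 2 - j ≤ f (2 * j - 1) / 2 - j ∧ stepLabels f j U = (InsLabel.a, InsLabel.a)))) := by
  unfold stepLabels
  by_cases h : rowDots U.dots j = ∅
  · simp [h]
  · rcases hl : U.lab j with _ | _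
    · simp [h]
    · by_cases hlt : f (2 * j - 1) / 2 - j < f (2 * j) / 2 - j
      · simp [h, hlt]
      · simp [h, hlt]
        omega

theorem Good.insert_dot (g : Good n j V) (h1 : 1 ≤ j) (h2 : j ≤ n) {r : ℕ}
    (hr : Avail n (j + 1) V r) (hc : ∀ k i, (k, i) ∈ V → k < j + 1) :
    Good n j (insert (j, r) V) where
  le := g.le
  mem k i hk := by
    rcases Finset.mem_insert.1 hk with hk | hk
    · obtain ⟨rfl, rfl⟩ := Prod.mk.inj hk
      exact ⟨h1, h2, g.le_of_avail ⟨hr.1, hr.2.1, fun k hk => hr.2.2 k (by omega)⟩, hr.2.1⟩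
    · exact g.mem _ _ hk
  inj k k' i hk hk' := by
    rcases Finset.mem_insert.1 hk with e | hk <;> rcases Finset.mem_insert.1 hk' with e' | hk'
    · rw [(Prod.mk.inj e).1, (Prod.mk.inj e').1]
    · rw [(Prod.mk.inj e).2] at hk'
      exact absurd hk' (hr.2.2 _ (hc _ _ hk'))
    · rw [(Prod.mk.inj e').2] at hk
      exact absurd hk (hr.2.2 _ (hc _ _ hk))
    · exact g.inj _ _ _ hk hk'
  col k hk hk' := by
    rw [← g.col k hk hk']
    congr 1
    ext i
    simp only [mem_colDots, Finset.mem_insert, Prod.mk.injEq, or_iff_right_iff_imp, and_imp]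
    omega
  row i hi hi' := by
    obtain ⟨k, hk⟩ := g.row i hi hi'
    exact ⟨k, Finset.mem_insert_of_mem hk⟩

section Step

variable {U : LabeledTableau} {r : ℕ}

/-- If the target of the first dot was an empty row, the first dot now occupies it with the label
`a`, which sends `b` to the twin row. If `h > 0` and the row was occupied, `a` and `b` are compared
with the same label; at height `0` the rule separates them directly. -/
theorem Good.insertionRow_ne_of_labels (g : Good n j U.dots) (hj : 1 ≤ j)
    (hc : ∀ k i, (k, i) ∈ U.dots → k < j) (hr : Avail n j U.dots r) {h : ℕ} (hh : j + h ≤ n)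
    (ha : arrival n U.dots j r = insertionRow n f j U InsLabel.a h) :
    insertionRow n f j U InsLabel.a h ≠ insertionRow n f j
      ⟨insert (j, r) U.dots, Function.update U.lab r InsLabel.a⟩ InsLabel.b h := by
  have hn : n ≠ 0 := by omega
  have hfix : ∀ i, j ≤ i → i ≤ n → rowDots U.dots i = ∅ → arrival n U.dots j r = i → i = r := by
    intro i h1 h2 h3 h4
    refine g.arrival_inj ⟨by omega, by omega, fun k _ => rowDots_eq_empty.1 h3 k⟩ hr ?_
    rw [h4]
    exact arrival_of_settled (by unfold Settled; omega)
  have hne : ∀ i, rowDots U.dots i ≠ ∅ → i ≠ r := by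
    rintro i hi rfl
    rw [Ne, rowDots_eq_empty] at hi
    push Not at hi
    obtain ⟨k, hk⟩ := hi
    exact hr.2.2 k (hc _ _ hk) hk
  have hne' : ∀ i, rowDots U.dots i ≠ ∅ ∨ i = r → rowDots (insert (j, r) U.dots) i ≠ ∅ := by
    intro i hi
    rw [Ne, rowDots_eq_empty]
    push Not
    rcases hi with hi | rfl
    · rw [Ne, rowDots_eq_empty] at hi
      push Not at hi
      obtain ⟨k, hk⟩ := hi
      exact ⟨k, Finset.mem_insert_of_mem hk⟩
    · exact ⟨j, Finset.mem_insert_self _ _⟩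
  by_cases h0 : h = 0
  · subst h0
    have e : insertionRow n f j U InsLabel.a 0 = j := by simp [insertionRow]
    rw [e] at ha ⊢
    have : rowDots (insert (j, r) U.dots) j ≠ ∅ := by
      by_cases he : rowDots U.dots j = ∅
      · exact hne' j (Or.inr (hfix j le_rfl (by omega) he ha))
      · exact hne' j (Or.inl he)
    simp [insertionRow, this, hn]
  · by_cases he : rowDots U.dots (j + h) = ∅
    · have e : insertionRow n f j U InsLabel.a h = j + h := by simp [insertionRow, he, h0]
      rw [e] at ha ⊢
      have hr' := hfix (j + h) (by omega) hh he ha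
      have := hne' _ (Or.inr hr')
      simp only [insertionRow, if_neg h0, if_neg this]
      rw [hr']
      simp [hn]
    · have := hne' _ (Or.inl he)
      simp only [insertionRow, if_neg h0, if_neg this, if_neg he, Function.update_of_ne (hne _ he)]
      cases U.lab (j + h) <;> simp [hn]

/-- The two dots could share a row only at equal heights. The labels `(a, b)` then separate them,
`(b, b)` requires `δ_o < δ_e`, and `(a, a)` gives equal heights only if `f(2j) = 2j`, which an
earlier dot of `R_j` labeled `b` forbids. -/
theorem exists_step (hf : f ∈ SP n) (h1 : 1 ≤ j) (h2 : j ≤ n) (g : Good n j U.dots)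
    (hc : ∀ k i, (k, i) ∈ U.dots → k < j) (S : Spec n f (j - 1) U.dots U.lab) :
    ∃ r s, r ≠ s ∧ Avail n j U.dots r ∧ Avail n j U.dots s ∧
      arrival n U.dots j r = insertionRow n f j U (stepLabels f j U).1 (stepHeights f j U).1 ∧
      arrival n U.dots j s = insertionRow n f j ⟨insert (j, r) U.dots,
        Function.update U.lab r (stepLabels f j U).1⟩ (stepLabels f j U).2 (stepHeights f j U).2 := by
  have hh := stepHeights_le hf h1 h2 (U := U)
  obtain ⟨r, hr, ha⟩ := g.arrival_surj h1 (settled_insertionRow (f := f) (U := U)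
    (l := (stepLabels f j U).1) hh.1)
  obtain ⟨s, hs, hb⟩ := g.arrival_surj h1 (settled_insertionRow (f := f)
    (U := ⟨insert (j, r) U.dots, Function.update U.lab r (stepLabels f j U).1⟩)
    (l := (stepLabels f j U).2) hh.2)
  refine ⟨r, s, ?_, hr, hs, ha, hb⟩
  rintro rfl
  have e := ha.symm.trans hb
  have o1 := insertionRow_eq_or (n := n) (f := f) (j := j) (U := U) (l := (stepLabels f j U).1)
    (h := (stepHeights f j U).1)
  have o2 := insertionRow_eq_or (n := n) (f := f) (j := j)
    (U := ⟨insert (j, r) U.dots, Function.update U.lab r (stepLabels f j U).1⟩)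
    (l := (stepLabels f j U).2) (h := (stepHeights f j U).2)
  have heq : (stepHeights f j U).1 = (stepHeights f j U).2 := by omega
  have v1 := SP.even_value hf (k := 2 * j - 1) (by omega) (by omega)
  have v2 := SP.even_value hf (k := 2 * j) (by omega) (by omega)
  rcases stepLabels_cases f j U with ⟨_, hl⟩ | ⟨hne, hb', ⟨hlt, hl⟩ | ⟨hle, hl⟩⟩
  · rw [← heq, hl] at e
    rw [hl] at ha
    exact g.insertionRow_ne_of_labels h1 hc hr hh.1 ha e
  · simp [stepHeights, hl] at heq
    omega
  · simp only [stepHeights, hl, true_and] at heq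
    have hf2 : f (2 * j) = 2 * j := by
      split_ifs at heq <;> omega
    rw [Ne, rowDots_eq_empty] at hne
    push Not at hne
    obtain ⟨k, hk⟩ := hne
    have := hc _ _ hk
    exact S.f_ne hf (by rwa [Nat.sub_add_cancel h1]) (by omega) hk this h2 hb' hf2

theorem insertStep_spec (hf : f ∈ SP n) (h1 : 1 ≤ j) (h2 : j ≤ n) (g : Good n j U.dots)
    (hc : ∀ k i, (k, i) ∈ U.dots → k < j) (S : Spec n f (j - 1) U.dots U.lab) :
    Good n (j + 1) (insertStep n f j U).dots ∧
      (∀ k i, (k, i) ∈ (insertStep n f j U).dots → k < j + 1) ∧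
      Spec n f j (insertStep n f j U).dots (insertStep n f j U).lab := by
  obtain ⟨r, s, hrs, hr, hs, ha, hb⟩ := exists_step hf h1 h2 g hc S
  have hr' : Avail n (j + 1) U.dots r := ⟨hr.1, hr.2.1, fun k _ hk => hr.2.2 k (hc _ _ hk) hk⟩
  have hc' : ∀ k i, (k, i) ∈ U.dots → k < j + 1 := fun k i h => (hc k i h).trans (by omega)
  have gU := g.insert_dot h1 h2 hr' hc'
  have hcon : ∀ k < j, ∀ i, (k, i) ∈ U.dots ↔ (k, i) ∈ insert (j, r) U.dots := by
    intro k hk i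
    simp only [Finset.mem_insert, Prod.mk.injEq, iff_or_self, and_imp]
    omega
  have hs' : Avail n (j + 1) (insert (j, r) U.dots) s := by
    refine ⟨hs.1, hs.2.1, fun k _ hk => ?_⟩
    rcases Finset.mem_insert.1 hk with hk | hk
    · exact hrs (Prod.mk.inj hk).2.symm
    · exact hs.2.2 k (hc _ _ hk) hk
  have hcU : ∀ k i, (k, i) ∈ insert (j, r) U.dots → k < j + 1 := by
    intro k i hk
    rcases Finset.mem_insert.1 hk with hk | hk
    · have := (Prod.mk.inj hk).1; omega
    · exact hc' _ _ hk
  have hb2 := hb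
  rw [g.arrival_congr hcon hs.1 hs.2.1] at hb2
  have hU : insertStep n f j U = ⟨insert (j, s) (insert (j, r) U.dots),
      Function.update (Function.update U.lab r (stepLabels f j U).1) s (stepLabels f j U).2⟩ := by
    unfold insertStep
    rw [insertAt_eq, insertAt_eq, g.insertBox_eq hr' ha]
    exact Good.insertBox_eq (U := ⟨insert (j, r) U.dots, _⟩) gU hs' hb2
  rw [hU]
  dsimp only
  have mem_iff : ∀ k i, (k, i) ∈ insert (j, s) (insert (j, r) U.dots) ↔
      (k = j ∧ (i = r ∨ i = s)) ∨ (k, i) ∈ U.dots := by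
    intro k i
    simp only [Finset.mem_insert, Prod.mk.injEq]
    tauto
  have mem_iff' : ∀ k < j, ∀ i, (k, i) ∈ U.dots ↔ (k, i) ∈ insert (j, s) (insert (j, r) U.dots) := by
    intro k hk i
    rw [mem_iff]
    constructor
    · exact Or.inr
    · rintro (⟨h, _⟩ | h)
      · omega
      · exact h
  have hp : Pair (insert (j, s) (insert (j, r) U.dots)) j r s := by
    refine ⟨hrs, ?_⟩
    ext i
    rw [mem_colDots, mem_iff, Finset.mem_insert, Finset.mem_singleton]
    constructor
    · rintro (⟨_, h⟩ | h)
      · exact h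
      · exact absurd (hc _ _ h) (lt_irrefl _)
    · exact fun h => Or.inl ⟨rfl, h⟩
  have hlab : ∀ k i, (k, i) ∈ U.dots → U.lab i = Function.update
      (Function.update U.lab r (stepLabels f j U).1) s (stepLabels f j U).2 i := by
    intro k i hk
    have hir : i ≠ r := by rintro rfl; exact hr.2.2 k (hc _ _ hk) hk
    have his : i ≠ s := by rintro rfl; exact hs.2.2 k (hc _ _ hk) hk
    rw [Function.update_of_ne his, Function.update_of_ne hir]
  have hcut : cut (insert (j, s) (insert (j, r) U.dots)) j = U.dots := by
    ext ⟨k, i⟩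
    rw [mem_cut]
    constructor
    · rintro ⟨h, hk⟩; exact (mem_iff' k hk i).2 h
    · intro h; exact ⟨(mem_iff' k (hc _ _ h) i).1 h, hc _ _ h⟩
  have gU' := gU.insert_dot h1 h2 hs' hcU
  refine ⟨⟨by omega, gU'.mem, gU'.inj, ?_, ?_⟩, ?_, ?_⟩
  · intro k hk hk'
    rcases Nat.lt_succ_iff_lt_or_eq.1 hk' with h | rfl
    · rw [← g.col k hk h]
      congr 1
      ext i
      rw [mem_colDots, mem_colDots, mem_iff' k h]
    · rw [hp.eq, Finset.card_pair hrs]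
  · intro i hi hi'
    rcases Nat.lt_succ_iff_lt_or_eq.1 hi' with h | rfl
    · obtain ⟨k, hk⟩ := g.row i hi h
      exact ⟨k, (mem_iff _ _).2 (Or.inr hk)⟩
    -- The step must leave `R_i` nonempty. If it was empty, `Spec.filled` forces one height to be
    -- `0`, and the first dot at height `0` lands in `R_i`.
    by_cases he : rowDots U.dots i = ∅
    · have hl : stepLabels f i U = (InsLabel.a, InsLabel.b) := by simp [stepLabels, he]
      have hav : Avail n i U.dots i :=
        ⟨h1, by omega, fun k _ => rowDots_eq_empty.1 he k⟩
      have hai : arrival n U.dots i i = i := arrival_of_settled (by unfold Settled; omega)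
      have key : i = r ∨ i = s := by
        simp only [stepHeights, hl, reduceCtorEq, false_and, if_false] at ha hb
        by_cases ho : f (2 * i - 1) / 2 - i = 0
        · left
          refine g.arrival_inj hav hr (hai.trans ?_)
          rw [ha, insertionRow, if_pos ho, if_pos (Or.inl he)]
        by_cases he' : f (2 * i) / 2 - i = 0
        · by_contra hcon
          push Not at hcon
          refine hcon.2 (g.arrival_inj hav hs (hai.trans ?_))
          rw [hb, insertionRow, if_pos he', if_pos]
          left
          rw [rowDots_eq_empty]
          intro k hk
          rcases Finset.mem_insert.1 hk with hk | hk
          · exact hcon.1 (Prod.mk.inj hk).2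
          · exact rowDots_eq_empty.1 he k hk
        · exfalso
          have hi1 : i - 1 + 1 = i := by omega
          obtain ⟨k, hk⟩ := S.filled hf (by rwa [hi1]) (by omega) (by rw [hi1]; omega)
            (by rw [hi1]; omega)
          rw [hi1] at hk
          exact rowDots_eq_empty.1 he k hk
      exact ⟨i, (mem_iff _ _).2 (Or.inl ⟨rfl, key⟩)⟩
    · rw [rowDots_eq_empty] at he
      push Not at he
      obtain ⟨k, hk⟩ := he
      exact ⟨k, (mem_iff _ _).2 (Or.inr hk)⟩
  · intro k i hk
    rcases (mem_iff k i).1 hk with h | h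
    · omega
    · have := hc _ _ h; omega
  · intro k hk hkj
    rcases Nat.lt_or_eq_of_le hkj with h | rfl
    · obtain ⟨r', s', Q⟩ := S k hk (by omega)
      exact ⟨r', s', Q.congr (g.mono (by omega)) (fun k' hk' => mem_iff' k' (by omega))
        (fun k' _ i hi => hlab k' i hi)⟩
    · have e1 : Function.update (Function.update U.lab r (stepLabels f k U).1) s
          (stepLabels f k U).2 r = (stepLabels f k U).1 := by
        rw [Function.update_of_ne hrs, Function.update_self]
      have e2 : Function.update (Function.update U.lab r (stepLabels f k U).1) s
          (stepLabels f k U).2 s = (stepLabels f k U).2 := Function.update_self _ _ _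
      refine ⟨r, s, hp, ?_, ?_, ?_⟩
      · rw [hcut, e1, e2, ← stepLabels_congr hlab]
      · rw [hcut, e1, ← insertionRow_congr hlab, ← stepHeights_congr hlab,
          ← g.arrival_congr mem_iff' hr.1 hr.2.1]
        exact ha
      · rw [hcut, e2, ← stepHeights_congr hlab, ← g.arrival_congr mem_iff' hs.1 hs.2.1, hb]
        apply insertionRow_congr
        intro k' i hi
        have : i ≠ s := by
          rintro rfl
          refine hs'.2.2 k' ?_ hi
          rcases Finset.mem_insert.1 hi with h | h
          · have := (Prod.mk.inj h).1; omega
          · have := hc _ _ h; omega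
        rw [Function.update_of_ne this]

end Step

theorem insertSteps_spec (hf : f ∈ SP n) {m : ℕ} (hm : m ≤ n) :
    Good n (m + 1) (insertSteps n f m).dots ∧
      (∀ k i, (k, i) ∈ (insertSteps n f m).dots → k < m + 1) ∧
      Spec n f m (insertSteps n f m).dots (insertSteps n f m).lab := by
  induction m with
  | zero =>
    refine ⟨⟨by omega, ?_, ?_, ?_, ?_⟩, ?_, ?_⟩
    any_goals simp [insertSteps]
    · intro k hk hk'; omega
    · intro k hk; omega
    · intro k hk hk'; omega
  | succ m ih =>
    obtain ⟨h1, h2, h3⟩ := ih (by omega)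
    exact insertStep_spec hf (by omega) hm h1 h2 h3

theorem Phi_mem_Tab (hf : f ∈ SP n) : Phi n f ∈ Tab n :=
  (insertSteps_spec hf le_rfl).1.mem_Tab

/-- A tableau described by the steps of the construction of `Φ(f)` is `Φ(f)`. -/
theorem Phi_eq_of_spec (g : Good n (n + 1) T) (S : Spec n f n T L) : Phi n f = T := by
  -- Labels can only be compared on plotted dots; elsewhere `lab` is arbitrary, and the rules do not
  -- read it.
  have key : ∀ m ≤ n, (insertSteps n f m).dots = cut T (m + 1) ∧
      ∀ k r, (k, r) ∈ cut T (m + 1) → (insertSteps n f m).lab r = L r := by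
    intro m
    induction m with
    | zero =>
      intro _
      have : cut T (0 + 1) = ∅ := by
        rw [Finset.eq_empty_iff_forall_notMem]
        rintro ⟨k, r⟩ h
        rw [mem_cut] at h
        have := g.mem _ _ h.1
        omega
      rw [this]
      simp [insertSteps]
    | succ m ih =>
      intro hm
      obtain ⟨hd, hl⟩ := ih (by omega)
      obtain ⟨r, s, Q⟩ := S (m + 1) (by omega) hm
      rcases hU : insertSteps n f m with ⟨V, M⟩
      rw [hU] at hd hl
      simp only at hd hl
      subst hd
      have gc := g.cut (j := m + 1) (by omega)
      have hcon : ∀ k < m + 1, ∀ i, (k, i) ∈ cut T (m + 1) ↔ (k, i) ∈ T := by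
        intro k hk i; simp [mem_cut, hk]
      have hcon' : ∀ k < m + 1, ∀ i, (k, i) ∈ insert (m + 1, r) (cut T (m + 1)) ↔ (k, i) ∈ T := by
        intro k hk i
        rw [Finset.mem_insert, hcon k hk, Prod.mk.injEq]
        exact ⟨fun h => h.resolve_left (by omega), Or.inr⟩
      have hr := g.mem _ _ Q.left
      have hs := g.mem _ _ Q.right
      have avr := g.avail Q.left
      have avs := g.avail Q.right
      have hr' : Avail n (m + 1 + 1) (cut T (m + 1)) r := by
        refine ⟨by omega, by omega, fun k _ hk => ?_⟩
        rw [mem_cut] at hk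
        exact avr.2.2 k hk.2 hk.1
      have hs' : Avail n (m + 1 + 1) (insert (m + 1, r) (cut T (m + 1))) s := by
        refine ⟨by omega, by omega, fun k _ hk => ?_⟩
        rcases Finset.mem_insert.1 hk with hk | hk
        · exact Q.ne (Prod.mk.inj hk).2.symm
        · rw [mem_cut] at hk
          exact avs.2.2 k hk.2 hk.1
      have gU := gc.insert_dot (by omega) hm hr' (fun k i h => by rw [mem_cut] at h; omega)
      have ha : arrival n (cut T (m + 1)) (m + 1) r = insertionRow n f (m + 1)
          ⟨cut T (m + 1), M⟩ (L r) (stepHeights f (m + 1) ⟨cut T (m + 1), L⟩).1 := by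
        rw [gc.arrival_congr hcon (by omega) (by omega), Q.odd, insertionRow_congr hl]
      have hb : arrival n (insert (m + 1, r) (cut T (m + 1))) (m + 1) s = insertionRow n f (m + 1)
          ⟨insert (m + 1, r) (cut T (m + 1)), Function.update M r (L r)⟩ (L s)
          (stepHeights f (m + 1) ⟨cut T (m + 1), L⟩).2 := by
        rw [gU.arrival_congr hcon' (by omega) (by omega), Q.even]
        apply insertionRow_congr
        intro k i hi
        by_cases hir : i = r
        · rw [hir, Function.update_self]
        · rw [Function.update_of_ne hir]
          rcases Finset.mem_insert.1 hi with h | h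
          · exact absurd (Prod.mk.inj h).2 hir
          · exact (hl k i h).symm
      have hstep : insertSteps n f (m + 1) = ⟨insert (m + 1, s) (insert (m + 1, r) (cut T (m + 1))),
          Function.update (Function.update M r (L r)) s (L s)⟩ := by
        rw [insertSteps, hU, insertStep, insertAt_eq, insertAt_eq, stepLabels_congr hl,
          stepHeights_congr hl, Q.labels, Good.insertBox_eq (U := ⟨cut T (m + 1), M⟩) gc hr' ha]
        exact Good.insertBox_eq (U := ⟨insert (m + 1, r) (cut T (m + 1)), _⟩) gU hs' hb
      have hmem : ∀ k i, (k, i) ∈ cut T (m + 1 + 1) ↔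
          k = m + 1 ∧ (i = r ∨ i = s) ∨ (k, i) ∈ cut T (m + 1) := by
        intro k i
        rw [mem_cut, mem_cut]
        constructor
        · rintro ⟨h, hk⟩
          rcases Nat.lt_succ_iff_lt_or_eq.1 hk with h' | rfl
          · exact Or.inr ⟨h, h'⟩
          · exact Or.inl ⟨rfl, Q.eq_or h⟩
        · rintro (⟨rfl, rfl | rfl⟩ | ⟨h, hk⟩)
          · exact ⟨Q.left, by omega⟩
          · exact ⟨Q.right, by omega⟩
          · exact ⟨h, by omega⟩
      rw [hstep]
      refine ⟨?_, ?_⟩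
      · ext ⟨k, i⟩
        rw [hmem]
        simp only [Finset.mem_insert, Prod.mk.injEq]
        tauto
      · intro k i hi
        simp only [Function.update_apply]
        split_ifs with h h'
        · rw [h]
        · rw [h']
        · rcases (hmem k i).1 hi with h'' | h''
          · tauto
          · exact hl k i h''
  rw [Phi, (key n le_rfl).1]
  ext ⟨k, r⟩
  rw [mem_cut]
  exact ⟨And.left, fun h => ⟨h, by have := g.mem _ _ h; omega⟩⟩

end

/-! ### The pistol labeling of `Φ(f)` -/

section

variable {n j : ℕ} {f : ℕ → ℕ} {T V : Finset (ℕ × ℕ)} {L : ℕ → InsLabel}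

theorem InsLabel.ne_a {l : InsLabel} : l ≠ InsLabel.a ↔ l = InsLabel.b := by
  cases l <;> simp

theorem InsLabel.eq_iff {l l' : InsLabel} : l = l' ↔ (l = InsLabel.a ↔ l' = InsLabel.a) := by
  cases l <;> cases l' <;> simp

theorem TypeLabel.eq_iff {l l' : TypeLabel} : l = l' ↔ (l = TypeLabel.α ↔ l' = TypeLabel.α) := by
  cases l <;> cases l' <;> simp

/-- Since `d_i` lies weakly to the left of `C_i`, only positions of `d_{n+i}` up to `C_i` need a
check. -/
theorem Good.dmin_eq (g : Good n (n + 1) T) {i : ℕ} (h1 : 1 ≤ i) (h2 : i ≤ n)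
    (h : ∀ k ≤ i, (k, n + i) ∈ T → ∃ k' ≤ k, (k', i) ∈ T) : dmin n T i = i := by
  have e1 := g.colOf_mem h1 (by omega)
  have e2 := g.colOf_mem (r := n + i) (by omega) (by omega)
  unfold dmin
  rw [if_pos]
  by_cases hk : SymplecticDellac.colOf T (n + i) ≤ i
  · obtain ⟨k', hk', h'⟩ := h _ hk e2
    rwa [g.colOf h']
  · have := g.mem _ _ e1
    omega

theorem Spec.dmin_eq (S : Spec n f n T L) (hf : f ∈ SP n) (g : Good n (n + 1) T) {i : ℕ}
    (h1 : 1 ≤ i) (h2 : i ≤ n) (hi : f (2 * i) ≠ 2 * i) : dmin n T i = i := by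
  refine g.dmin_eq h1 h2 fun k hk hki => ?_
  have hm := g.mem _ _ hki
  obtain ⟨r, s, Q⟩ := S k hm.1 hm.2.1
  obtain ⟨V, h, P⟩ := Q.placed hf hm.1 hm.2.1 hki
  exact P.exists_twin (g.mono (by omega)) hk h2 rfl hi

namespace StepSpec

variable {r s : ℕ}

theorem digit_odd (Q : StepSpec n f T L j r s) (hf : f ∈ SP n) (g : Good n (n + 1) T) :
    digitOf n T r = (stepHeights f j ⟨cut T j, L⟩).1 := by
  have hm := g.mem _ _ Q.left
  refine g.digit_eq Q.left (stepHeights_le hf hm.1 hm.2.1).1 ?_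
  rw [Q.odd]
  exact insertionRow_eq_or

theorem digit_even (Q : StepSpec n f T L j r s) (hf : f ∈ SP n) (g : Good n (n + 1) T) :
    digitOf n T s = (stepHeights f j ⟨cut T j, L⟩).2 := by
  have hm := g.mem _ _ Q.left
  refine g.digit_eq Q.right (stepHeights_le hf hm.1 hm.2.1).2 ?_
  rw [Q.even]
  exact insertionRow_eq_or

theorem rowDots_cut (g : Good n (n + 1) T) {k i : ℕ} (h : (k, i) ∈ T) :
    rowDots (cut T j) i ≠ ∅ ↔ k < j := by
  rw [Ne, rowDots_eq_empty]
  push Not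
  constructor
  · rintro ⟨k', hk'⟩
    rw [mem_cut] at hk'
    rw [g.inj _ _ _ h hk'.1]
    exact hk'.2
  · exact fun hk => ⟨k, mem_cut.2 ⟨h, hk⟩⟩

/-- The three cases of the rule for the labels, together with the digital labels. -/
theorem cases (Q : StepSpec n f T L j r s) (S : Spec n f n T L) (hf : f ∈ SP n)
    (g : Good n (n + 1) T) :
    ((rowDots (cut T j) j = ∅ ∨ L j = InsLabel.a) ∧ L r = InsLabel.a ∧ L s = InsLabel.b ∧
      f (2 * j) = 2 * (j + digitOf n T s)) ∨
    (rowDots (cut T j) j ≠ ∅ ∧ L j = InsLabel.b ∧ f (2 * j) ≠ 2 * j ∧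
      ((L r = InsLabel.b ∧ L s = InsLabel.b ∧ digitOf n T r < digitOf n T s ∧
        f (2 * j) = 2 * (j + digitOf n T s)) ∨
      (L r = InsLabel.a ∧ L s = InsLabel.a ∧ digitOf n T s < digitOf n T r ∧
        f (2 * j) = 2 * (j + if digitOf n T s = 0 then digitOf n T r else digitOf n T s)))) := by
  have hm := g.mem _ _ Q.left
  have v1 := SP.even_value hf (k := 2 * j - 1) (by omega) (by omega)
  have v2 := SP.even_value hf (k := 2 * j) (by omega) (by omega)
  have d1 := Q.digit_odd hf g
  have d2 := Q.digit_even hf g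
  have hl := Q.labels
  rcases stepLabels_cases f j ⟨cut T j, L⟩ with ⟨h1, h⟩ | ⟨h1, h2, h3⟩
  · left
    simp only [stepHeights, h, reduceCtorEq, false_and, if_false] at d1 d2
    rw [hl, Prod.mk.injEq] at h
    exact ⟨h1, h.1, h.2, by omega⟩
  · right
    have hne : f (2 * j) ≠ 2 * j := by
      have h1' := h1
      rw [Ne, rowDots_eq_empty] at h1'
      push Not at h1'
      obtain ⟨k, hk⟩ := h1'
      rw [mem_cut] at hk
      exact S.f_ne hf g (by omega) hk.1 hk.2 hm.2.1 h2
    refine ⟨h1, h2, hne, ?_⟩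
    rcases h3 with ⟨h3, h⟩ | ⟨h3, h⟩
    · left
      simp only [stepHeights, h, reduceCtorEq, false_and, if_false] at d1 d2
      rw [hl, Prod.mk.injEq] at h
      exact ⟨h.1, h.2, by omega, by omega⟩
    · right
      simp only [stepHeights, h, true_and] at d1 d2
      rw [hl, Prod.mk.injEq] at h
      refine ⟨h.1, h.2, ?_, ?_⟩
      -- For `δ_o = δ_e` the even height is `0`, while `δ_o > 0` by `hne`: hence the strict
      -- inequality.
      · split_ifs at d2 <;> omega
      · split_ifs at d2 ⊢ <;> omega

theorem f_odd (Q : StepSpec n f T L j r s) (hf : f ∈ SP n) (g : Good n (n + 1) T) :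
    f (2 * j - 1) = 2 * (j + digitOf n T r) := by
  have hm := g.mem _ _ Q.left
  have v1 := SP.even_value hf (k := 2 * j - 1) (by omega) (by omega)
  have d1 := Q.digit_odd hf g
  simp only [stepHeights] at d1
  omega

end StepSpec

/-- The dots of `C_j` are obtained in the step `j` of the construction of `Φ(f)`, and the labels
used in this step agree with the pistol labeling. -/
structure Matches (n : ℕ) (f : ℕ → ℕ) (T : Finset (ℕ × ℕ)) (L : ℕ → InsLabel) (j r s : ℕ) : Prop
    where
  step : StepSpec n f T L j r s
  oddEven : OddEven n T j r s
  left : (pistolLabel n T r).type = TypeLabel.α ↔ L r = InsLabel.a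
  right : (pistolLabel n T s).type = TypeLabel.α ↔ L s = InsLabel.a

namespace Matches

variable {r s : ℕ}

theorem hasBeta_iff (M : Matches n f T L j r s) (S : Spec n f n T L) (hf : f ∈ SP n)
    (g : Good n (n + 1) T) : HasBetaZeroEven T (pistolLabel n T) j ↔ f (2 * j) = 2 * j := by
  rw [M.oddEven.hasBeta_iff g, ← TypeLabel.ne_α, Ne, M.right]
  have hm := g.mem _ _ M.step.left
  rcases M.step.cases S hf g with ⟨_, _, h1, h2⟩ |
    ⟨_, _, h, ⟨_, h1, h2, h3⟩ | ⟨_, h1, h2, h3⟩⟩ <;> simp only [h1, reduceCtorEq, not_true_eq_false,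
      not_false_eq_true, true_and, false_and, false_iff] <;> omega

/-- Step `j` uses two equal labels precisely when it finds a dot labeled `b` in `R_j`. -/
theorem sameType_iff (M : Matches n f T L j r s) (S : Spec n f n T L) (hf : f ∈ SP n)
    (g : Good n (n + 1) T) :
    SameType T (pistolLabel n T) j ↔ rowDots (cut T j) j ≠ ∅ ∧ L j = InsLabel.b := by
  rw [M.oddEven.sameType_iff, TypeLabel.eq_iff, M.left, M.right]
  rcases M.step.cases S hf g with ⟨h0, h, h1, _⟩ |
    ⟨h, h', _, ⟨h0, h1, _⟩ | ⟨h0, h1, _⟩⟩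
  · rw [← InsLabel.ne_a]
    simp only [h, h1, reduceCtorEq, iff_false]
    tauto
  · simp [*]
  · simp [*]

end Matches

/-- Put `i = j + h`. If `f(2i) = 2i`, both labels only test whether the arrival is `i`. Otherwise
`d_{i,min} = d_i`, and type `α` means that `L t = L i` holds iff `L i = a`, that is, `L t = a`. -/
theorem Placed.type_iff {t u h : ℕ} (P : Placed n f T L j V t h) (p : Pair T j t u)
    (S : Spec n f n T L) (hf : f ∈ SP n) (g : Good n (n + 1) T) (hd : digitOf n T t = h)
    (hh : 0 < h) (ih : ∀ k > j, k ≤ n → ∃ r s, Matches n f T L k r s) :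
    (pistolLabel n T t).type = TypeLabel.α ↔ L t = InsLabel.a := by
  obtain ⟨r, s, M⟩ := ih (j + h) (by omega) P.le
  have hm := g.mem _ _ P.mem
  have gj : Good n j T := g.mono (by omega)
  subst hd
  rw [p.type_pos g hh]
  simp only [M.hasBeta_iff S hf g]
  split_ifs with h0
  · refine (P.label_iff_of_eq hh h0 fun k hk hkT => ?_).symm
    by_contra hl
    exact S.f_ne hf g (by have := g.mem _ _ hkT; omega) hkT hk P.le (InsLabel.ne_a.1 hl) h0
  · obtain ⟨k, hk, hkT⟩ := P.filled gj hh h0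
    have hne : rowDots (cut T (j + digitOf n T t)) (j + digitOf n T t) ≠ ∅ :=
      (StepSpec.rowDots_cut g hkT).2 (by omega)
    rw [M.sameType_iff S hf g, S.dmin_eq hf g (by omega) P.le h0, ← P.label_iff_of_ne gj hh h0]
    generalize L (j + digitOf n T t) = l at *
    cases l <;> cases L t <;> simp [hne]

/-- The induction descends because types depend on the columns to the right. `Placed.type_iff`
covers positive heights; the rules for digital label `0` are checked in each case of
`StepSpec.cases`. -/
theorem exists_matches (S : Spec n f n T L) (hf : f ∈ SP n) (g : Good n (n + 1) T) (h1 : 1 ≤ j)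
    (h2 : j ≤ n) : ∃ r s, Matches n f T L j r s := by
  obtain ⟨m, hm⟩ : ∃ m, n - j = m := ⟨_, rfl⟩
  induction m using Nat.strong_induction_on generalizing j with
  | _ m ih =>
  have ih' : ∀ k > j, k ≤ n → ∃ r s, Matches n f T L k r s := fun k hk hkn =>
    ih (n - k) (by omega) (by omega) hkn rfl
  obtain ⟨r, s, Q⟩ := S j h1 h2
  have gj : Good n j T := g.mono (by omega)
  have p := Q.toPair
  have Po := Q.placed_odd hf h1 h2
  have Pe := Q.placed_even hf h1 h2
  rw [← Q.digit_odd hf g] at Po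
  rw [← Q.digit_even hf g] at Pe
  have hto : 0 < digitOf n T r → ((pistolLabel n T r).type = TypeLabel.α ↔ L r = InsLabel.a) :=
    fun h => Po.type_iff p S hf g rfl h ih'
  have hte : 0 < digitOf n T s → ((pistolLabel n T s).type = TypeLabel.α ↔ L s = InsLabel.a) :=
    fun h => Pe.type_iff p.symm S hf g rfl h ih'
  have zo : digitOf n T r = 0 →
      (arrival n T j r = j ↔ rowDots (cut T j) j = ∅ ∨ L r = InsLabel.a) := fun h => by
    rw [h] at Po; exact Po.arrival_zero_iff gj
  have ze : digitOf n T s = 0 →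
      (arrival n T j s = j ↔ rowDots (insert (j, r) (cut T j)) j = ∅ ∨ L s = InsLabel.a) :=
    fun h => by rw [h] at Pe; exact Pe.arrival_zero_iff gj
  have har := g.arrival_ne p.left p.right p.ne
  have key : ((pistolLabel n T r).type = TypeLabel.α ↔ L r = InsLabel.a) ∧
      ((pistolLabel n T s).type = TypeLabel.α ↔ L s = InsLabel.a) := by
    rcases Q.cases S hf g with ⟨h0, hr, hs, hv⟩ | ⟨h0, h0', hv0, ⟨hr, hs, hlt, hv⟩ | ⟨hr, hs, hlt, hv⟩⟩
    · by_cases hdr : digitOf n T r = 0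
      · have ar := (zo hdr).2 (Or.inr hr)
        by_cases hds : digitOf n T s = 0
        · rw [p.type_zero_zero g hdr hds, p.symm.type_zero_zero g hds hdr]
          simp only [hr, hs, ar, reduceCtorEq, iff_false, true_and]
          exact fun h => har (ar.trans h.symm)
        · have hts := hte (by omega)
          refine ⟨?_, hts⟩
          rw [p.type_zero_β g hdr (by omega) (TypeLabel.ne_α.1 (by rw [Ne, hts, hs]; simp)),
            S.dmin_eq hf g h1 h2 (by omega)]
          simp [ar, hr]
      · have htr := hto (by omega)
        refine ⟨htr, ?_⟩
        by_cases hds : digitOf n T s = 0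
        · rw [p.symm.type_zero_α g hds (by omega) (htr.2 hr)]
          simp only [hs, reduceCtorEq, iff_false, not_and]
          -- An even dot labeled `b` arrives at `j` only if `R_j` is still empty, and then it is
          -- `d_j` itself, contrary to `hne`.
          intro hne ha
          rcases (ze hds).1 ha with he | he
          · exact hne ((Pe.eq_of_arrival gj h1 le_rfl h2 he ha).trans ha.symm)
          · rw [hs] at he; cases he
        · exact hte (by omega)
    · have hts := hte (by omega)
      refine ⟨?_, hts⟩
      by_cases hdr : digitOf n T r = 0
      · rw [p.type_zero_β g hdr (by omega) (TypeLabel.ne_α.1 (by rw [Ne, hts, hs]; simp)),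
          S.dmin_eq hf g h1 h2 hv0, zo hdr]
        simp [h0]
      · exact hto (by omega)
    · have htr := hto (by omega)
      refine ⟨htr, ?_⟩
      by_cases hds : digitOf n T s = 0
      · rw [p.symm.type_zero_α g hds (by omega) (htr.2 hr)]
        have ha := (ze hds).2 (Or.inr hs)
        simp only [hs, ha, iff_true, and_true]
        -- The dot cannot be `d_j`, because `R_j` was filled before step `j`.
        rintro rfl
        exact h0 (by
          by_contra hc
          exact lt_irrefl _ ((StepSpec.rowDots_cut g p.right).1 hc))
      · exact hte (by omega)
  have hpar : (pistolLabel n T r).parity = ParityLabel.o := by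
    rw [p.parity_iff g, ← TypeLabel.ne_α, ← TypeLabel.ne_α, Ne, Ne, key.1, key.2]
    rcases Q.cases S hf g with ⟨_, hr, hs, _⟩ | ⟨_, _, _, ⟨hr, hs, hlt, _⟩ | ⟨hr, hs, hlt, _⟩⟩ <;>
      simp [hr, hs] <;> omega
  refine ⟨r, s, Q, ⟨p, hpar, ParityLabel.ne_o.1 fun h => p.parity_ne g ?_⟩, key.1, key.2⟩
  simp [hpar, h]

theorem phi_eq_of_spec (S : Spec n f n T L) (hf : f ∈ SP n) (g : Good n (n + 1) T) :
    phi n T = f := by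
  ext k
  by_cases hk : k ∈ Set.Icc 1 (2 * n)
  · have hk1 := hk.1
    have hk2 := hk.2
    obtain ⟨c, hc1, hc2, hc⟩ : ∃ c, 1 ≤ c ∧ c ≤ n ∧ (k = 2 * c - 1 ∨ k = 2 * c) :=
      ⟨(k + 1) / 2, by omega, by omega, by omega⟩
    obtain ⟨r, s, M⟩ := exists_matches S hf g hc1 hc2
    rcases hc with rfl | rfl
    · rw [M.oddEven.phi_odd g, M.step.f_odd hf g]
    · rw [M.oddEven.phi_even g]
      simp only [M.right]
      rcases M.step.cases S hf g with ⟨_, hr, hs, hv⟩ |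
        ⟨_, _, _, ⟨hr, hs, hlt, hv⟩ | ⟨hr, hs, hlt, hv⟩⟩
      · simp [hs, hv]
      · simp [hs, hv]
      · simp only [hs, hv, true_and]
        split_ifs <;> rfl
  · rw [hf.1 k hk]
    simp only [phi]
    rw [if_neg]
    simpa using hk

theorem Good.twinType_eq (g : Good n (n + 1) T) {i : ℕ} (h1 : 1 ≤ i) (h2 : i ≤ n)
    (h : (j, i) ∈ T) (h' : (j, n + i) ∈ T) : twinType n T j = (pistolLabel n T i).type := by
  have p : Pair T j i (n + i) := by
    obtain ⟨s, hs, e⟩ := g.exists_other h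
    rcases Pair.eq_or ⟨hs, e⟩ h' with h3 | h3
    · omega
    · exact ⟨by omega, by rw [e, ← h3]⟩
  have : (Finset.Icc 1 n).filter (fun i => ContainsTwins n T j i) = {i} := by
    ext a
    simp only [Finset.mem_filter, Finset.mem_singleton, ContainsTwins, Finset.mem_Icc]
    constructor
    · rintro ⟨_, ⟨h3, h4⟩, h5, h6⟩
      have := g.colOf_mem h3 (by omega)
      rw [h5] at this
      rcases p.eq_or this with h | h <;> omega
    · rintro rfl
      exact ⟨⟨h1, h2⟩, ⟨h1, h2⟩, g.colOf h, g.colOf h'⟩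
  simp [twinType, this]

/-- For (b): twins in one column have equal digital labels, so step `j` used `(a, b)`; as `f(2i) ≠
2i`, the first dot went into the empty row `R_i`. Thus `d_i` is the odd dot, labeled `a`. -/
theorem mem_TabTilde_of_spec (S : Spec n f n T L) (hf : f ∈ SP n) (g : Good n (n + 1) T) :
    T ∈ TabTilde n := by
  refine ⟨g.mem_Tab, ?_, ?_⟩
  · rintro i ⟨hi, _, _, hb⟩
    rw [Finset.mem_Icc] at hi
    obtain ⟨r, s, M⟩ := exists_matches S hf g hi.1 hi.2
    rw [M.hasBeta_iff S hf g] at hb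
    exact S.dmin_eq hf g hi.1 hi.2 hb
  · rintro j ⟨hj, i, ⟨hi, hi1, hi2⟩, hb⟩
    rw [Finset.mem_Icc] at hi hj
    obtain ⟨r', s', M'⟩ := exists_matches S hf g hi.1 hi.2
    rw [M'.hasBeta_iff S hf g] at hb
    have m1 := g.colOf_mem (r := i) (by omega) (by omega)
    have m2 := g.colOf_mem (r := n + i) (by omega) (by omega)
    rw [hi1] at m1
    rw [hi2] at m2
    rw [g.twinType_eq hi.1 hi.2 m1 m2]
    have hm := g.mem _ _ m1
    have a1 : arrival n T j i = i := arrival_of_settled (by unfold Settled; omega)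
    have a2 : arrival n T j (n + i) = n + i := arrival_of_settled (by unfold Settled; omega)
    have d1 : digitOf n T i = i - j := g.digit_eq m1 (by omega) (by omega)
    have d2 : digitOf n T (n + i) = i - j := g.digit_eq m2 (by omega) (by omega)
    obtain ⟨r, s, M⟩ := exists_matches S hf g hj.1 hj.2
    have gj : Good n j T := g.mono (by omega)
    have Po := M.step.placed_odd hf hj.1 hj.2
    have Pe := M.step.placed_even hf hj.1 hj.2
    rw [← M.step.digit_odd hf g] at Po
    rw [← M.step.digit_even hf g] at Pe
    have hdd : digitOf n T r = digitOf n T s ∧ digitOf n T s = i - j := by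
      rcases M.step.eq_or m1 with h1 | h1 <;> rcases M.step.eq_or m2 with h2 | h2
      · omega
      · rw [← h1, ← h2]; omega
      · rw [← h1, ← h2]; omega
      · omega
    rcases M.step.cases S hf g with ⟨h0, hr, hs, hv⟩ |
      ⟨_, _, _, ⟨_, _, hlt, _⟩ | ⟨_, _, hlt, _⟩⟩
    · have hij : i ≠ j := by rintro rfl; omega
      rcases M.step.eq_or m1 with h1 | h1
      · rw [h1, M.left, hr]
      · exfalso
        have h2 : n + i = r := (M.step.eq_or m2).resolve_right (by omega)
        have he : rowDots (cut T j) i = ∅ := by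
          by_contra hc
          exact lt_irrefl _ ((StepSpec.rowDots_cut g m1).1 hc)
        have hji : j + digitOf n T r = i := by omega
        have := Po.arr
        rw [insertionRow, if_neg (by omega), hji, if_pos he, if_neg (fun h => hb h.2), ← h2] at this
        omega
    · omega
    · omega

end

/-! ### Tableaux satisfying (a) and (b) obey the insertion rule -/

section

variable {n j : ℕ} {T V : Finset (ℕ × ℕ)}

namespace OddEven

variable {r s : ℕ}

theorem cases (q : OddEven n T j r s) (g : Good n (n + 1) T) :
    ((pistolLabel n T r).type = TypeLabel.α ∧ (pistolLabel n T s).type = TypeLabel.β) ∨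
    ((pistolLabel n T r).type = TypeLabel.β ∧ (pistolLabel n T s).type = TypeLabel.β ∧
      digitOf n T r < digitOf n T s) ∨
    ((pistolLabel n T r).type = TypeLabel.α ∧ (pistolLabel n T s).type = TypeLabel.α ∧
      digitOf n T s < digitOf n T r) := by
  have hne := q.type_ne g
  rcases (q.parity_iff g).1 q.odd with h | ⟨h1, h2, h3⟩ | h
  · exact Or.inl h
  · refine Or.inr (Or.inr ⟨h1, h2, lt_of_le_of_ne h3 fun e => hne e.symm ?_⟩)
    simp [h1, h2]
  · exact Or.inr (Or.inl h)

theorem not_sameType_of_hasBeta (q : OddEven n T j r s) (g : Good n (n + 1) T)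
    (h : HasBetaZeroEven T (pistolLabel n T) j) : ¬ SameType T (pistolLabel n T) j := by
  rw [q.hasBeta_iff g] at h
  rw [q.sameType_iff, h.1]
  rcases q.cases g with h' | h' | h'
  · simp [h'.1]
  · omega
  · simp [h'.1]

theorem hasBeta_last (q : OddEven n T n r s) (g : Good n (n + 1) T) :
    HasBetaZeroEven T (pistolLabel n T) n := by
  have h1 := g.digit_spec q.left
  have h2 := g.digit_spec q.right
  rw [q.hasBeta_iff g]
  rcases q.cases g with h | h | h
  · exact ⟨h.2, by omega⟩
  · omega
  · omega

end OddEven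

/-- This removes the restrictions in `setS`. For `i < n`, `d_{n+i}` has level `2n - i` and is free
exactly when it lies to the right of `C_i`, hence of `d_i`. Twins in one column satisfy the claim by
convention, and `C_n` always has a dot `β_0^e`. -/
theorem dmin_of_mem_TabTilde (hT : T ∈ TabTilde n) {i : ℕ} (h1 : 1 ≤ i) (h2 : i ≤ n)
    (hb : ¬ HasBetaZeroEven T (pistolLabel n T) i) : dmin n T i = i := by
  have g := Good.of_mem_Tab hT.1
  by_cases hk : colOf T (n + i) ≤ i
  · by_cases hc : colOf T i = colOf T (n + i)
    · unfold dmin; rw [if_pos hc.le]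
    · refine hT.2.1 i ⟨Finset.mem_Icc.2 ⟨h1, h2⟩, ?_, hc, hb⟩
      have : i ≠ n := by
        rintro rfl
        obtain ⟨r, s, q⟩ := g.exists_oddEven h1 h2
        exact hb (q.hasBeta_last g)
      unfold IsFree level
      split_ifs <;> omega
  · have := g.mem _ _ (g.colOf_mem h1 (by omega))
    unfold dmin; rw [if_pos (by omega)]

/-- The type of the dot `d_j`, if it lies strictly to the left of `C_j`. -/
theorem type_of_lt (hT : T ∈ TabTilde n) {k : ℕ} (h : (k, j) ∈ T) (hk : k < j) (hj : j ≤ n) :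
    (pistolLabel n T j).type = TypeLabel.α ↔ ¬ SameType T (pistolLabel n T) j := by
  have g := Good.of_mem_Tab hT.1
  have hm := g.mem _ _ h
  obtain ⟨u, hu, e⟩ := g.exists_other h
  have p : Pair T k j u := ⟨hu, e⟩
  obtain ⟨r, s, q⟩ := g.exists_oddEven (j := j) (by omega) hj
  have ha : arrival n T k j = j := arrival_of_settled (by unfold Settled; omega)
  have hd : digitOf n T j = j - k := g.digit_eq h (by omega) (by omega)
  have hkj : k + (j - k) = j := by omega
  rw [p.type_pos g (by omega), hd, hkj, ha]
  split_ifs with hb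
  · simpa using q.not_sameType_of_hasBeta g hb
  · rw [dmin_of_mem_TabTilde hT (by omega) hj hb]
    simp

/-- If one dot of `C_j` has a positive digital label and the type `β`, and the other one the digital
label `0`, no dot of `C_j` is labeled `β_0^e`. -/
theorem not_hasBeta (g : Good n (n + 1) T) {t u : ℕ} (p : Pair T j t u) (h0 : digitOf n T t = 0)
    (h1 : 0 < digitOf n T u) (hu : (pistolLabel n T u).type = TypeLabel.β) :
    ¬ HasBetaZeroEven T (pistolLabel n T) j := by
  have hm := g.mem _ _ p.left
  obtain ⟨r, s, q⟩ := g.exists_oddEven (j := j) hm.1 hm.2.1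
  rw [q.hasBeta_iff g]
  rintro ⟨h2, h3⟩
  have hs : s = t := (p.eq_or q.right).resolve_right (by rintro rfl; omega)
  have hr : r = u := (p.eq_or q.left).resolve_left (by rw [← hs]; exact q.ne)
  subst hs hr
  rcases q.cases g with h | h | h
  · rw [h.1] at hu; cases hu
  · omega
  · rw [h.1] at hu; cases hu

/-- If `d_j` is in `C_j`, the dots of `C_j` have different types. -/
theorem not_sameType_of_mem (hT : T ∈ TabTilde n) (h : (j, j) ∈ T) (hj : j ≤ n) :
    ¬ SameType T (pistolLabel n T) j := by
  have g := Good.of_mem_Tab hT.1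
  have hm := g.mem _ _ h
  obtain ⟨u, hu, e⟩ := g.exists_other h
  have p : Pair T j j u := ⟨hu, e⟩
  have ha : arrival n T j j = j := arrival_of_settled (by unfold Settled; omega)
  have hd : digitOf n T j = 0 := g.digit_eq h (by omega) (by omega)
  rw [p.sameType_iff, TypeLabel.eq_iff]
  by_cases hd' : digitOf n T u = 0
  · exact p.type_ne g (hd.trans hd'.symm)
  · rcases hu : (pistolLabel n T u).type with _ | _
    · rw [p.type_zero_α g hd (by omega) hu]
      simp [ha]
    · rw [p.type_zero_β g hd (by omega) hu, dmin_of_mem_TabTilde hT hm.1 hj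
        (not_hasBeta g p hd (by omega) hu)]
      simp [ha]

/-- The insertion label corresponding to a type label. -/
def insLabel : TypeLabel → InsLabel
  | TypeLabel.α => InsLabel.a
  | TypeLabel.β => InsLabel.b

theorem insLabel_eq_a {t : TypeLabel} : insLabel t = InsLabel.a ↔ t = TypeLabel.α := by
  cases t <;> simp [insLabel]

theorem insLabel_eq_b {t : TypeLabel} : insLabel t = InsLabel.b ↔ t = TypeLabel.β := by
  cases t <;> simp [insLabel]

/-- The type labels of `T`, as insertion labels. -/
def typeLab (n : ℕ) (T : Finset (ℕ × ℕ)) (i : ℕ) : InsLabel := insLabel (pistolLabel n T i).type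

-- The core of `Φ(φ(T)) = T`: with types as labels, each dot arrives where the insertion rule sends
-- it. `V` is the tableau seen when `d_t` is inserted, so the odd dot is present only for the even
-- one.
set_option maxHeartbeats 400000 in
theorem insertionRow_of_mem_TabTilde (hT : T ∈ TabTilde n) {r s t u : ℕ} (q : OddEven n T j r s)
    (p : Pair T j t u)
    (hV : (t = r ∧ V = cut T j) ∨ (t = s ∧ V = insert (j, r) (cut T j))) :
    arrival n T j t =
      insertionRow n (phi n T) j ⟨V, typeLab n T⟩ (typeLab n T t) (digitOf n T t) := by
  have g := Good.of_mem_Tab hT.1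
  have hm := g.mem _ _ p.left
  have gj : Good n j T := g.mono (by omega)
  have hds := g.digit_spec p.left
  have sub : ∀ k i, (k, i) ∈ V → (k, i) ∈ T ∧ k ≤ j := by
    intro k i h
    rcases hV with ⟨_, rfl⟩ | ⟨_, rfl⟩
    · exact ⟨(mem_cut.1 h).1, (mem_cut.1 h).2.le⟩
    · rcases Finset.mem_insert.1 h with h | h
      · obtain ⟨rfl, rfl⟩ := Prod.mk.inj h
        exact ⟨q.left, le_rfl⟩
      · exact ⟨(mem_cut.1 h).1, (mem_cut.1 h).2.le⟩
  have sup : ∀ k i, (k, i) ∈ T → k < j → (k, i) ∈ V := by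
    intro k i h hk
    rcases hV with ⟨_, rfl⟩ | ⟨_, rfl⟩
    · exact mem_cut.2 ⟨h, hk⟩
    · exact Finset.mem_insert_of_mem (mem_cut.2 ⟨h, hk⟩)
  have htV : rowDots V t = ∅ := by
    rw [rowDots_eq_empty]
    intro k hk
    have := g.inj _ _ _ (sub _ _ hk).1 p.left
    subst this
    rcases hV with ⟨rfl, rfl⟩ | ⟨rfl, rfl⟩
    · exact lt_irrefl _ (mem_cut.1 hk).2
    · rcases Finset.mem_insert.1 hk with h | h
      · exact q.ne (Prod.mk.inj h).2.symm
      · exact lt_irrefl _ (mem_cut.1 h).2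
  -- If the other dot `d_i` of the column is not yet plotted, then `d_t` is the odd dot, which comes
  -- first.
  have heven : ∀ i, rowDots V i = ∅ → (j, i) ∈ T → i ≠ t → t = r ∧ i = s := by
    intro i he hi hit
    rcases hV with ⟨rfl, rfl⟩ | ⟨rfl, rfl⟩
    · exact ⟨rfl, (q.eq_or hi).resolve_left hit⟩
    · obtain rfl := (q.eq_or hi).resolve_right hit
      exact absurd (Finset.mem_insert_self _ _) (rowDots_eq_empty.1 he j)
  by_cases h0 : digitOf n T t = 0
  · have key : arrival n T j t = j ↔ rowDots V j = ∅ ∨ typeLab n T t = InsLabel.a := by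
      rw [typeLab, insLabel_eq_a]
      have aj : arrival n T j j = j := arrival_of_settled (by unfold Settled; omega)
      have hjT : rowDots V j = ∅ → (j, j) ∈ T := by
        intro he
        obtain ⟨k, hk⟩ := g.exists_mem (r := j) hm.1 (by omega)
        have hkj := g.mem _ _ hk
        rcases Nat.lt_or_eq_of_le hkj.2.2.1 with h | rfl
        · exact absurd (sup _ _ hk h) (rowDots_eq_empty.1 he k)
        · exact hk
      have dj : (j, j) ∈ T → digitOf n T j = 0 := fun h => g.digit_eq h (by omega) (by omega)
      by_cases h0' : digitOf n T u = 0
      · rw [p.type_zero_zero g h0 h0', iff_comm, or_iff_right_iff_imp]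
        intro he
        have hjj := hjT he
        rcases p.eq_or hjj with h | h
        · rw [← h]; exact aj
        -- Otherwise `d_j` is even of type `α` with both digital labels `0`, which the parity rule
        -- excludes.
        · exfalso
          have htj : j ≠ t := by rw [h]; exact p.ne.symm
          obtain ⟨h2, h3⟩ := heven j he hjj htj
          have tα := (p.symm.type_zero_zero g h0' h0).2 (by rw [← h]; exact aj)
          rw [← h, h3] at tα
          rcases q.cases g with h | h | h
          · rw [tα] at h; cases h.2
          · rw [← h3, dj hjj] at h; omega
          · rw [← h2] at h; omega
      · have htj : rowDots V j = ∅ → t = j := fun he =>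
          ((p.eq_or (hjT he)).resolve_right (by rintro rfl; exact h0' (dj (hjT he)))).symm
        have htj' : rowDots V j = ∅ → arrival n T j t = j := fun he => by rw [htj he, aj]
        rcases hu : (pistolLabel n T u).type with _ | _
        · rw [p.type_zero_α g h0 (by omega) hu]
          constructor
          · intro ha
            by_cases htt : t = arrival n T j t
            · left; rw [← ha, ← htt]; exact htV
            · exact Or.inr ⟨htt, ha⟩
          · rintro (h | h)
            · exact htj' h
            · exact h.2
        · rw [p.type_zero_β g h0 (by omega) hu, dmin_of_mem_TabTilde hT hm.1 hm.2.1
            (not_hasBeta g p h0 (by omega) hu)]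
          exact ⟨Or.inr, fun h => h.elim htj' id⟩
    rw [insertionRow, if_pos h0]
    split_ifs with h
    · exact key.2 h
    · have := mt key.1 h
      omega
  · obtain ⟨i, hi⟩ : ∃ i, i = j + digitOf n T t := ⟨_, rfl⟩
    obtain ⟨r', s', q'⟩ := g.exists_oddEven (j := i) (by omega) (by omega)
    have hty := p.type_pos g (Nat.pos_of_ne_zero h0)
    rw [insertionRow, if_neg h0]
    simp only [q'.phi_eq_iff g, ← hi] at hty hds ⊢
    have hlab : rowDots V i ≠ ∅ →
        (typeLab n T i = InsLabel.a ↔ ¬ SameType T (pistolLabel n T) i) := by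
      intro he
      rw [Ne, rowDots_eq_empty] at he
      push Not at he
      obtain ⟨k, hk⟩ := he
      have := sub _ _ hk
      rw [typeLab, insLabel_eq_a]
      exact type_of_lt hT this.1 (by omega) hds.1
    by_cases hb : HasBetaZeroEven T (pistolLabel n T) i
    · rw [if_pos hb, ← insLabel_eq_a] at hty
      change typeLab n T t = InsLabel.a ↔ _ at hty
      by_cases he : rowDots V i = ∅
      · simp only [he, hb, and_true, if_true, ← InsLabel.ne_a, Ne, hty]
        split_ifs <;> omega
      · rw [if_neg he, (hlab he).2 (q'.not_sameType_of_hasBeta g hb)]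
        simp only [hty]
        split_ifs <;> omega
    · have hdm := dmin_of_mem_TabTilde hT (by omega) hds.1 hb
      rw [if_neg hb, hdm, ← insLabel_eq_a] at hty
      change typeLab n T t = InsLabel.a ↔ _ at hty
      by_cases he : rowDots V i = ∅
      · simp only [he, hb, and_false, if_true, if_false]
        -- If the arrival were `n + i` with `R_i` empty, `d_{i,min} = d_i` would put both twins into
        -- `C_j`, with `d_i` even. Then (b) gives `d_i` type `α`, which an even dot can have only
        -- with the strictly smaller digital label.
        refine hds.2.resolve_right fun ha => ?_
        have e1 := g.colOf_mem (r := i) (by omega) (by omega)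
        have e2 := g.colOf_mem (r := n + i) (by omega) (by omega)
        have hc1 : j ≤ colOf T i := by
          by_contra hc
          exact rowDots_eq_empty.1 he _ (sup _ _ e1 (by omega))
        have hc2 : colOf T i ≤ colOf T (n + i) := by
          by_contra hc
          unfold dmin at hdm
          rw [if_neg hc] at hdm
          omega
        have htn : n + i = t := by
          refine gj.arrival_inj ⟨by omega, by omega, fun k hk hkT => ?_⟩ (g.avail p.left)
            ((arrival_of_settled (by unfold Settled; omega)).trans ha.symm)
          have := g.colOf hkT
          omega
        have hcj : colOf T (n + i) = j := by rw [htn]; exact g.colOf p.left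
        have hcj' : colOf T i = j := by omega
        rw [hcj'] at e1
        rw [hcj] at e2
        obtain ⟨h2, h3⟩ := heven i he e1 (by omega)
        have htα := hT.2.2 j ⟨Finset.mem_Icc.2 ⟨hm.1, hm.2.1⟩, i,
          ⟨Finset.mem_Icc.2 ⟨by omega, hds.1⟩, hcj', hcj⟩, hb⟩
        rw [g.twinType_eq (by omega) hds.1 e1 e2, h3] at htα
        have hdi : digitOf n T i = i - j :=
          g.digit_eq e1 (by omega) (Or.inl (by
            rw [arrival_of_settled (by unfold Settled; omega)]; omega))
        rcases q.cases g with h | h | h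
        · rw [htα] at h; cases h.2
        · rw [htα] at h; cases h.2.1
        · rw [← h3, ← h2] at h; omega
      · have h1 := hlab he
        rw [if_neg he]
        have : typeLab n T t = typeLab n T i ↔ arrival n T j t = i := by
          rw [InsLabel.eq_iff, h1, hty]
          by_cases hs : SameType T (pistolLabel n T) i <;> simp [hs]
        simp only [this]
        split_ifs <;> omega

/-- The fact `hsame` translates the types in `C_j` into the state of `R_j` before step `j`, so that
`stepLabels` recovers the types and `stepHeights` the digital labels. -/
theorem spec_of_mem_TabTilde (hT : T ∈ TabTilde n) : Spec n (phi n T) n T (typeLab n T) := by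
  intro j h1 h2
  have g := Good.of_mem_Tab hT.1
  obtain ⟨r, s, q⟩ := g.exists_oddEven h1 h2
  have vo := q.phi_odd g
  have ve := q.phi_even g
  have hsame : SameType T (pistolLabel n T) j ↔
      rowDots (cut T j) j ≠ ∅ ∧ typeLab n T j = InsLabel.b := by
    obtain ⟨k, hk⟩ := g.exists_mem (r := j) h1 (by omega)
    rw [StepSpec.rowDots_cut g hk]
    rcases Nat.lt_or_eq_of_le (g.mem _ _ hk).2.2.1 with h | rfl
    · rw [← InsLabel.ne_a, Ne, typeLab, insLabel_eq_a, type_of_lt hT hk h h2, not_not]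
      simp [h]
    · simpa using not_sameType_of_mem hT hk h2
  rw [q.sameType_iff] at hsame
  have hlr : ∀ t, (pistolLabel n T t).type = TypeLabel.α → typeLab n T t = InsLabel.a :=
    fun t h => insLabel_eq_a.2 h
  have hlr' : ∀ t, (pistolLabel n T t).type = TypeLabel.β → typeLab n T t = InsLabel.b :=
    fun t h => insLabel_eq_b.2 h
  have key : stepLabels (phi n T) j ⟨cut T j, typeLab n T⟩ = (typeLab n T r, typeLab n T s) ∧
      stepHeights (phi n T) j ⟨cut T j, typeLab n T⟩ = (digitOf n T r, digitOf n T s) := by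
    rcases q.cases g with ⟨hr, hs⟩ | ⟨hr, hs, hlt⟩ | ⟨hr, hs, hlt⟩
    · rw [if_neg (by simp [hs])] at ve
      rw [hr, hs] at hsame
      have hl : stepLabels (phi n T) j ⟨cut T j, typeLab n T⟩ = (InsLabel.a, InsLabel.b) := by
        rcases stepLabels_cases (phi n T) j ⟨cut T j, typeLab n T⟩ with h | ⟨h, h', _⟩
        · exact h.2
        · exact absurd (hsame.2 ⟨h, h'⟩) (by simp)
      refine ⟨by rw [hl, hlr r hr, hlr' s hs], ?_⟩
      simp only [stepHeights, hl, vo, ve, reduceCtorEq, false_and, if_false, Prod.mk.injEq]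
      omega
    · rw [if_neg (by simp [hs])] at ve
      obtain ⟨h3, h4⟩ := hsame.1 (by rw [hr, hs])
      have hl : stepLabels (phi n T) j ⟨cut T j, typeLab n T⟩ = (InsLabel.b, InsLabel.b) := by
        rcases stepLabels_cases (phi n T) j ⟨cut T j, typeLab n T⟩ with
          ⟨h | h, _⟩ | ⟨_, _, h | h⟩
        · exact absurd h h3
        · exact absurd (h.symm.trans h4) (by simp)
        · exact h.2
        · omega
      refine ⟨by rw [hl, hlr' r hr, hlr' s hs], ?_⟩
      simp only [stepHeights, hl, vo, ve, reduceCtorEq, false_and, if_false, Prod.mk.injEq]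
      omega
    · simp only [hs, true_and] at ve
      obtain ⟨h3, h4⟩ := hsame.1 (by rw [hr, hs])
      have hl : stepLabels (phi n T) j ⟨cut T j, typeLab n T⟩ = (InsLabel.a, InsLabel.a) := by
        rcases stepLabels_cases (phi n T) j ⟨cut T j, typeLab n T⟩ with
          ⟨h | h, _⟩ | ⟨_, _, h | h⟩
        · exact absurd h h3
        · exact absurd (h.symm.trans h4) (by simp)
        · split_ifs at ve <;> omega
        · exact h.2
      refine ⟨by rw [hl, hlr r hr, hlr s hs], ?_⟩
      simp only [stepHeights, hl, vo, true_and, Prod.mk.injEq]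
      -- For an even dot `α_0`, `φ` repeats the odd value; the reset of the even height for `δ_o =
      -- δ_e` undoes this.
      split_ifs at ve ⊢ <;> omega
  refine ⟨r, s, q.toPair, key.1, ?_, ?_⟩
  · rw [key.2]
    exact insertionRow_of_mem_TabTilde hT q q.toPair (Or.inl ⟨rfl, rfl⟩)
  · rw [key.2]
    exact insertionRow_of_mem_TabTilde hT q q.symm (Or.inr ⟨rfl, rfl⟩)

end

end SymplecticDellac


open SymplecticDellac in
theorem mainTheorem6 (n : ℕ) (hn : 1 ≤ n) :
    Set.MapsTo (SymplecticDellac.phi n) (SymplecticDellac.Tab n) (SymplecticDellac.SP n) ∧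
    Set.MapsTo (SymplecticDellac.Phi n) (SymplecticDellac.SP n) (SymplecticDellac.Tab n) ∧
    Set.InjOn (SymplecticDellac.phi n) (SymplecticDellac.TabTilde n) ∧
    (∀ T ∈ SymplecticDellac.TabTilde n,
      SymplecticDellac.Phi n (SymplecticDellac.phi n T) = T) ∧
    SymplecticDellac.Phi n '' SymplecticDellac.SP n = SymplecticDellac.TabTilde n ∧
    Set.BijOn (SymplecticDellac.Phi n) (SymplecticDellac.SP n) (SymplecticDellac.TabTilde n) := by
  have inv : ∀ T ∈ TabTilde n, Phi n (phi n T) = T := fun T hT =>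
    Phi_eq_of_spec (Good.of_mem_Tab hT.1) (spec_of_mem_TabTilde hT)
  have inv' : ∀ f ∈ SP n, phi n (Phi n f) = f := fun f hf => by
    obtain ⟨g, _, S⟩ := insertSteps_spec hf le_rfl
    exact phi_eq_of_spec S hf g
  have maps : Set.MapsTo (Phi n) (SP n) (TabTilde n) := fun f hf => by
    obtain ⟨g, _, S⟩ := insertSteps_spec hf le_rfl
    exact mem_TabTilde_of_spec S hf g
  have surj : Set.SurjOn (Phi n) (SP n) (TabTilde n) := fun T hT =>
    ⟨phi n T, phi_mem_SP hT.1, inv T hT⟩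
  exact ⟨fun T hT => phi_mem_SP hT, fun f hf => Phi_mem_Tab hf, Set.LeftInvOn.injOn inv, inv,
    Set.Subset.antisymm maps.image_subset surj, maps, Set.LeftInvOn.injOn inv', surj⟩
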